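/- Let $T^*=\mathbf{R}^5$ and let $\mathbf{R}^{10}=T\oplus T^*$ carry the quadratic form $(X+\xi,X+\xi)=i_X\xi$ of signature $(5,5)$. Its Clifford algebra (with $v\cdot v=(v,v)1$) acts on $\Lambda^{*}T^*$ by $(X+\xi)\cdot\varphi=i_X\varphi+\xi\wedge\varphi$. Let $S$ be either of the two $16$-dimensional half-spin representations $\Lambda^{ev}T^*$, $\Lambda^{od}T^*$ of $Spin(5,5)$, and let $Spin(5,5)\times GL(2,\mathbf{R})$ act on $S\otimes\mathbf{R}^2$ in the standard way. Suppose that $\rho\in S\otimes\mathbf{R}^2$ lies in an open orbit of this group. Then $\rho$ determines a $3$-dimensional subspace $V=V_\rho\subset\mathbf{R}^{10}$ such that: (i) the restriction to $V$ of $q$, where $q$ is either the quadratic form $(\cdot,\cdot)$ or its negative, has signature $(2,1)$; (ii) for every basis $e_1,e_2,e_3$ of $V$ that is orthonormal for $q$, with $q(e_1)=q(e_2)=1$ and $q(e_3)=-1$, put $\omega=e_1\cdot e_2\cdot e_3$ in the Clifford algebra; then there is a linear isomorphism $a:V\to\mathfrak{sl}(2,\mathbf{R})$ such that for all $v\in V$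 $$v\cdot\rho=a(v)\,\omega\cdot\rho ,\qquad \mathrm{tr}\,a(v)^2=2\,q(v),$$ where the Clifford algebra acts on the factor $S$ and the matrix $a(v)$ on the factor $\mathbf{R}^2$. Here "determines" means that $V_\rho$ is the only $3$-dimensional subspace of $\mathbf{R}^{10}$ satisfying (i) and (ii), and that it depends equivariantly on $\rho$: $V_{(g,A)\rho}=g\,V_\rho\,g^{-1}$ for all $g\in Spin(5,5)$ and $A\in GL(2,\mathbf{R})$. -/

import Mathlib

open scoped TensorProduct Topology

noncomputable section

namespace SpinFiveFive

/-- `T* = ℝ⁵`. -/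
abbrev E5 : Type := Fin 5 → ℝ

/-- `ℝ¹⁰ = T ⊕ T*`, with `T` the dual of `T*`. -/
abbrev R10 : Type := Module.Dual ℝ E5 × E5

/-- The quadratic form `(X + ξ, X + ξ) = i_X ξ` of signature `(5,5)` on `ℝ¹⁰`. -/
abbrev Q10 : QuadraticForm ℝ R10 := QuadraticForm.dualProd ℝ E5

/-- The exterior algebra `Λ T*`, on which the Clifford algebra of `ℝ¹⁰` acts. -/
abbrev Forms : Type := ExteriorAlgebra ℝ E5

/-- Clifford multiplication by a vector: `(X + ξ) · φ = i_X φ + ξ ∧ φ`. -/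
def vecAct : R10 →ₗ[ℝ] Module.End ℝ Forms :=
  (CliffordAlgebra.contractLeft (Q := (0 : QuadraticForm ℝ E5))).comp
      (LinearMap.fst ℝ (Module.Dual ℝ E5) E5) +
    (LinearMap.mul ℝ Forms).comp
      ((ExteriorAlgebra.ι ℝ (M := E5)).comp (LinearMap.snd ℝ (Module.Dual ℝ E5) E5))

theorem vecAct_apply (v : R10) (φ : Forms) :
    vecAct v φ = CliffordAlgebra.contractLeft (Q := (0 : QuadraticForm ℝ E5)) v.1 φ
      + ExteriorAlgebra.ι ℝ v.2 * φ := rfl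

theorem vecAct_sq (v : R10) :
    vecAct v * vecAct v = algebraMap ℝ (Module.End ℝ Forms) (Q10 v) := by
  refine LinearMap.ext fun φ => ?_
  have h1 := CliffordAlgebra.contractLeft_contractLeft (Q := (0 : QuadraticForm ℝ E5)) v.1 φ
  have h2 := CliffordAlgebra.contractLeft_ι_mul (Q := (0 : QuadraticForm ℝ E5)) (d := v.1) v.2 φ
  have h3 : ExteriorAlgebra.ι ℝ v.2 * (ExteriorAlgebra.ι ℝ v.2 * φ) = 0 := by
    rw [← mul_assoc, ExteriorAlgebra.ι_sq_zero, zero_mul]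
  simp only [Module.End.mul_apply, vecAct_apply, map_add, h3,
    Module.algebraMap_end_apply, QuadraticForm.dualProd_apply]
  erw [h1, h2]
  abel

/-- The action of the Clifford algebra of `ℝ¹⁰` on forms; vectors satisfy `v · v = (v,v)`. -/
def cliffAct : CliffordAlgebra Q10 →ₐ[ℝ] Module.End ℝ Forms :=
  CliffordAlgebra.lift Q10 ⟨vecAct, vecAct_sq⟩

/-- The two half-spin representations: `Λ^ev T*` for `p = 0` and `Λ^od T*` for `p = 1`. -/
abbrev HalfSpin (p : ZMod 2) : Submodule ℝ Forms :=
  CliffordAlgebra.evenOdd (0 : QuadraticForm ℝ E5) p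

theorem vecAct_mem {p : ZMod 2} (v : R10) {φ : Forms} (hφ : φ ∈ HalfSpin p) :
    vecAct v φ ∈ HalfSpin (p + 1) := by
  rw [vecAct_apply]
  refine Submodule.add_mem _ ?_ ?_
  · induction φ, hφ using CliffordAlgebra.evenOdd_induction with
    | range_ι_pow w h =>
      have hp : p = 0 ∨ p = 1 := (by decide : ∀ q : ZMod 2, q = 0 ∨ q = 1) p
      rcases hp with rfl | rfl
      · obtain ⟨r, rfl⟩ := Submodule.mem_one.mp (by simpa using h)
        rw [CliffordAlgebra.contractLeft_algebraMap]
        exact Submodule.zero_mem _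
      · have h' : w ∈ LinearMap.range (CliffordAlgebra.ι (0 : QuadraticForm ℝ E5)) := by
          simpa [ZMod.val_one] using h
        obtain ⟨m, rfl⟩ := h'
        rw [CliffordAlgebra.contractLeft_ι]
        exact SetLike.algebraMap_mem_graded
          (CliffordAlgebra.evenOdd (0 : QuadraticForm ℝ E5)) _
    | add x y hx hy ihx ihy => rw [map_add]; exact Submodule.add_mem _ ihx ihy
    | ι_mul_ι_mul m₁ m₂ x hx ih =>
      have hι := fun m => CliffordAlgebra.ι_mem_evenOdd_one (0 : QuadraticForm ℝ E5) m
      have key : ∀ m {y : Forms} {q : ZMod 2}, y ∈ HalfSpin q →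
          CliffordAlgebra.ι (0 : QuadraticForm ℝ E5) m * y ∈ HalfSpin (q + 1) := by
        intro m y q hy
        rw [add_comm]
        exact SetLike.mul_mem_graded (hι m) hy
      have two : ∀ q : ZMod 2, q + 1 + 1 = q := by decide
      rw [mul_assoc, CliffordAlgebra.contractLeft_ι_mul, CliffordAlgebra.contractLeft_ι_mul]
      refine Submodule.sub_mem _ (Submodule.smul_mem _ _ (key _ hx)) ?_
      have := key m₁ (Submodule.sub_mem _ (Submodule.smul_mem _ (v.1 m₂) hx)
        (by simpa only [two] using key m₂ ih))
      exact this
  · rw [add_comm]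
    exact SetLike.mul_mem_graded
      (CliffordAlgebra.ι_mem_evenOdd_one (0 : QuadraticForm ℝ E5) v.2) hφ

theorem cliffAct_even_mem {p : ZMod 2} {x : CliffordAlgebra Q10}
    (hx : x ∈ CliffordAlgebra.evenOdd Q10 0) :
    ∀ φ ∈ HalfSpin p, cliffAct x φ ∈ HalfSpin p := by
  induction x, hx using CliffordAlgebra.even_induction with
  | algebraMap r =>
    intro φ hφ
    rw [AlgHom.commutes, Module.algebraMap_end_apply]
    exact Submodule.smul_mem _ _ hφ
  | add x y hx hy ihx ihy =>
    intro φ hφ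
    rw [map_add, LinearMap.add_apply]
    exact Submodule.add_mem _ (ihx φ hφ) (ihy φ hφ)
  | ι_mul_ι_mul m₁ m₂ x hx ih =>
    intro φ hφ
    have two : ∀ q : ZMod 2, q + 1 + 1 = q := by decide
    have h := vecAct_mem m₁ (vecAct_mem m₂ (ih φ hφ))
    rw [two] at h
    simpa [cliffAct] using h

/-- The half-spin representation of `Spin(5,5)` on `S = HalfSpin p`. -/
def halfSpinRep (p : ZMod 2) : spinGroup Q10 →* Module.End ℝ (HalfSpin p) where
  toFun g := (cliffAct (g : CliffordAlgebra Q10)).restrict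
    (cliffAct_even_mem (spinGroup.mem_even g.2))
  map_one' := by ext φ; simp
  map_mul' g h := by ext φ; simp

/-- `S ⊗ ℝ²`. -/
abbrev Spinor2 (p : ZMod 2) : Type := (HalfSpin p) ⊗[ℝ] (Fin 2 → ℝ)

/-- The representation of `Spin(5,5) × GL(2,ℝ)` on `S ⊗ ℝ²`. -/
def spinGLRep (p : ZMod 2) :
    spinGroup Q10 × GL (Fin 2) ℝ →* Module.End ℝ (Spinor2 p) where
  toFun g := TensorProduct.map (halfSpinRep p g.1) (Matrix.toLin' (g.2 : Matrix (Fin 2) (Fin 2) ℝ))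
  map_one' := by simp [Module.End.one_eq_id]
  map_mul' g h := by
    simp [Matrix.toLin'_mul, Module.End.mul_eq_comp, TensorProduct.map_comp]

/-- The orbit of `ρ` under `Spin(5,5) × GL(2,ℝ)`. -/
def spinGLOrbit {p : ZMod 2} (ρ : Spinor2 p) : Set (Spinor2 p) :=
  Set.range fun g => spinGLRep p g ρ

/-- `ρ` lies in an open orbit, for the usual topology of the finite-dimensional
real vector space `S ⊗ ℝ²`. -/
def InOpenOrbit {p : ZMod 2} (ρ : Spinor2 p) : Prop :=
  IsOpen[moduleTopology ℝ (Spinor2 p)] (spinGLOrbit ρ)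

/-- `x · (1 ⊗ A) ρ` for `x` in the Clifford algebra and a `2 × 2` matrix `A`. The value is taken
in `Λ T* ⊗ ℝ²`, which contains both `S ⊗ ℝ²` and `S* ⊗ ℝ²`. -/
def cliffMul {p : ZMod 2} (x : CliffordAlgebra Q10) (A : Matrix (Fin 2) (Fin 2) ℝ)
    (ρ : Spinor2 p) : Forms ⊗[ℝ] (Fin 2 → ℝ) :=
  TensorProduct.map ((cliffAct x).comp (HalfSpin p).subtype) (Matrix.toLin' A) ρ

/-- A real quadratic form is nondegenerate of signature `(r, s)`. -/
def HasSignature {M : Type*} [AddCommGroup M] [Module ℝ M] (q : QuadraticForm ℝ M)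
    (r s : ℕ) : Prop :=
  Module.finrank ℝ M = r + s ∧ sigPos q = r ∧ sigNeg q = s

/-- `e₀, e₁, e₂` is a `q`-orthonormal frame of `V` with `q(e₀) = q(e₁) = 1`, `q(e₂) = -1`. -/
def IsFrame (q : QuadraticForm ℝ R10) (V : Submodule ℝ R10) (e : Fin 3 → R10) : Prop :=
  (∀ i, e i ∈ V) ∧ (∀ i j, i ≠ j → QuadraticMap.polar q (e i) (e j) = 0) ∧
    q (e 0) = 1 ∧ q (e 1) = 1 ∧ q (e 2) = -1

/-- The volume element `ω = e₀ · e₁ · e₂` in the Clifford algebra of `ℝ¹⁰`. -/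
def volElt (e : Fin 3 → R10) : CliffordAlgebra Q10 :=
  CliffordAlgebra.ι Q10 (e 0) * CliffordAlgebra.ι Q10 (e 1) * CliffordAlgebra.ι Q10 (e 2)

/-- `V` is three-dimensional, `q = ±Q10` has signature `(2,1)` on `V`, and for the volume element
`ω` of any orthonormal frame of `V` one has `v · ρ = a(v) ω · ρ` for `v ∈ V`, where
`a : V → sl(2,ℝ)` is a linear isomorphism with `tr a(v)² = 2 q(v)`. -/
def IsSpinorSubspace {p : ZMod 2} (ρ : Spinor2 p) (V : Submodule ℝ R10) : Prop :=
  Module.finrank ℝ V = 3 ∧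
    ∃ q : QuadraticForm ℝ R10, (q = Q10 ∨ q = -Q10) ∧ HasSignature (M := V) (q.restrict V) 2 1 ∧
      ∀ e : Fin 3 → R10, IsFrame q V e →
        ∃ a : V ≃ₗ[ℝ] LieAlgebra.SpecialLinear.sl (Fin 2) ℝ, ∀ v : V,
          cliffMul (CliffordAlgebra.ι Q10 (v : R10)) 1 ρ =
            cliffMul (volElt e) (a v : Matrix (Fin 2) (Fin 2) ℝ) ρ ∧
          Matrix.trace ((a v : Matrix (Fin 2) (Fin 2) ℝ) ^ 2) = 2 * q (v : R10)

end SpinFiveFive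

end

/-!
Write `ρ = (φ, ψ)` with half-spinors `φ, ψ`. The pairing `⟨φ, ψ⟩ = (φᵗ ∧ ψ)_top` makes Clifford
multiplication by vectors self-adjoint (`pairing_vecAct`), and so defines a symmetric map `β` from
pairs of spinors to vectors, `polar x β(φ, ψ) = ⟨x φ, ψ⟩ + ⟨x ψ, φ⟩`. The subspace is
`V_ρ = span (β(φ, φ), β(φ, ψ), β(ψ, ψ))`.

Everything rests on one observation: if a vector `v ≠ 0` annihilates `φ`, then `φ = v x φ` for any
`x` with `polar v x = 1`, so that `β(φ, φ)` is a multiple of `v`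
(`spinorVec_self_of_vecAct_eq_zero`).

* It gives the cubic identity `β(φ, φ) φ = 0` for half-spinors (`spinorVec_act_self`). An even form
  with nonzero scalar part is `e^b (a + c)` with `b` of degree two and `c` of degree four, and it is
  annihilated by a nonzero vector because `c` is a contraction of the volume form. The remaining even
  forms follow by polynomiality, and odd forms by a reflection.
* Polarizing the cubic identity gives all products of `u = β(φ, φ)`, `w = β(φ, ψ)`, `z = β(ψ, ψ)` on
  `φ` and `ψ` in terms of the single number `c = polar u z`, the quartic invariant
  (`IsSpinorTriple`). If `c ≠ 0`, then `V_ρ` has signature `(2, 1)` up to sign, products of two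
  vectors of `V_ρ` preserve the span of `φ, ψ`, and multiplying the vectors of a frame by the volume
  element `ω` produces the matrices `a(v)` (`IsSpinorTriple.exists_linearMap`). As `ω` commutes
  with `V_ρ` and `ω² = ±1`, one has `v² = a(v)² ω²` on `ρ`, which yields `a(v)² = q(v)`.
* It gives uniqueness: for a subspace `W` as in the theorem and a combination `χ = s φ + t ψ`, a
  suitable nilpotent `a(v)` shows that some nonzero `v ∈ W` annihilates `χ`. Hence `β(χ, χ) ∈ W` for
  all `s, t`, and `V_ρ ⊆ W` (`IsSpinorSubspace.eq_spinorSpan`).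

The quartic invariant is a nonzero polynomial, so every open orbit has a point where `c ≠ 0`
(`exists_quartic_ne_zero_of_isOpen`). The property defining `V_ρ` is transported by the group
(`IsSpinorSubspace.map`). This carries existence and uniqueness to the whole orbit and, together
with uniqueness, gives equivariance.
-/

noncomputable section

namespace SpinFiveFive

/-! ### Clifford multiplication on forms -/

theorem vecAct_vecAct (v : R10) (φ : Forms) : vecAct v (vecAct v φ) = Q10 v • φ := by
  have h := LinearMap.congr_fun (vecAct_sq v) φ
  simpa only [Module.End.mul_apply, Module.algebraMap_end_apply] using h

/-- The polar form of `Q10` is the natural pairing of `T` and `T*`. -/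
theorem polar_Q10 (v w : R10) : QuadraticMap.polar Q10 v w = v.1 w.2 + w.1 v.2 := by
  simp only [QuadraticMap.polar, QuadraticForm.dualProd_apply, Prod.fst_add, Prod.snd_add,
    LinearMap.add_apply, map_add]
  ring

theorem vecAct_anticomm (v w : R10) (φ : Forms) :
    vecAct v (vecAct w φ) + vecAct w (vecAct v φ) = QuadraticMap.polar Q10 v w • φ := by
  have h := vecAct_vecAct (v + w) φ
  simp only [map_add, LinearMap.add_apply, vecAct_vecAct] at h
  rw [QuadraticMap.polar, sub_smul, sub_smul, ← h]
  abel

/-- Contraction `i_X` of forms. -/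
abbrev contr (X : Module.Dual ℝ E5) : Forms →ₗ[ℝ] Forms :=
  CliffordAlgebra.contractLeft (Q := (0 : QuadraticForm ℝ E5)) X

theorem contr_ι_mul (X : Module.Dual ℝ E5) (m : E5) (φ : Forms) :
    contr X (ExteriorAlgebra.ι ℝ m * φ) = X m • φ - ExteriorAlgebra.ι ℝ m * contr X φ :=
  CliffordAlgebra.contractLeft_ι_mul _ _ _

theorem contr_ι (X : Module.Dual ℝ E5) (m : E5) :
    contr X (ExteriorAlgebra.ι ℝ m) = algebraMap ℝ Forms (X m) :=
  CliffordAlgebra.contractLeft_ι _ X m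

theorem contr_one (X : Module.Dual ℝ E5) : contr X 1 = 0 :=
  CliffordAlgebra.contractLeft_one _ X

theorem contr_contr (X : Module.Dual ℝ E5) (φ : Forms) : contr X (contr X φ) = 0 :=
  CliffordAlgebra.contractLeft_contractLeft _ _

theorem contr_comm (X Y : Module.Dual ℝ E5) (φ : Forms) :
    contr X (contr Y φ) = -contr Y (contr X φ) :=
  CliffordAlgebra.contractLeft_comm _ _ _

theorem vecAct_fst (X : Module.Dual ℝ E5) (φ : Forms) : vecAct (X, 0) φ = contr X φ := by
  rw [vecAct_apply]; simp

theorem vecAct_snd (ξ : E5) (φ : Forms) :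
    vecAct (0, ξ) φ = ExteriorAlgebra.ι ℝ ξ * φ := by
  rw [vecAct_apply]; simp

/-! ### The pairing of spinors -/

/-- The `i`-th coordinate vector of `T`, the `i`-th coordinate functional on `T*`. -/
abbrev coord (i : Fin 5) : Module.Dual ℝ E5 := LinearMap.proj i

/-- The coefficient of the volume form, computed by contracting with a basis of `T`
and taking the scalar part. -/
def topCoeff : Forms →ₗ[ℝ] ℝ :=
  (ExteriorAlgebra.algebraMapInv (R := ℝ) (M := E5)).toLinearMap ∘ₗ
    contr (coord 4) ∘ₗ contr (coord 3) ∘ₗ contr (coord 2) ∘ₗ contr (coord 1) ∘ₗ contr (coord 0)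

theorem dual_eq_sum (X : Module.Dual ℝ E5) : X = ∑ i, X (Pi.single i 1) • coord i := by
  refine LinearMap.pi_ext' fun i => LinearMap.ext_ring ?_
  simp [Pi.single_apply]

/-- The top coefficient of a contraction vanishes: five basis contractions and a further one
multiply to zero. -/
theorem topCoeff_contr (X : Module.Dual ℝ E5) (φ : Forms) : topCoeff (contr X φ) = 0 := by
  have key : ∀ i, topCoeff (contr (coord i) φ) = 0 := by
    have c := fun (i j : Fin 5) (x : Forms) => contr_comm (coord i) (coord j) x
    have z := fun (i : Fin 5) (x : Forms) => contr_contr (coord i) x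
    intro i
    simp only [topCoeff, LinearMap.comp_apply]
    fin_cases i
    · simp [z]
    · simp [c 0 1, z]
    · simp [c 0 2, c 1 2, z]
    · simp [c 0 3, c 1 3, c 2 3, z]
    · simp [c 0 4, c 1 4, c 2 4, c 3 4, z]
  have h : contr X φ = ∑ i, X (Pi.single i 1) • contr (coord i) φ := by
    conv_lhs => rw [dual_eq_sum X]
    simp only [contr, map_sum, map_smul, LinearMap.sum_apply, LinearMap.smul_apply]
  rw [h, map_sum]
  exact Finset.sum_eq_zero fun i _ => by rw [map_smul, key, smul_zero]

/-- The pairing `⟨φ, ψ⟩`, the top coefficient of `φᵗ ∧ ψ`, where `φᵗ` reverses the order of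
the factors. -/
def pairing : Forms →ₗ[ℝ] Forms →ₗ[ℝ] ℝ :=
  ((LinearMap.mul ℝ Forms).comp
    (CliffordAlgebra.reverse (Q := (0 : QuadraticForm ℝ E5)))).compr₂ topCoeff

theorem pairing_apply (φ ψ : Forms) :
    pairing φ ψ = topCoeff (CliffordAlgebra.reverse (Q := (0 : QuadraticForm ℝ E5)) φ * ψ) := rfl

theorem pairing_ι_mul (m : E5) (φ ψ : Forms) :
    pairing (ExteriorAlgebra.ι ℝ m * φ) ψ = pairing φ (ExteriorAlgebra.ι ℝ m * ψ) := by
  rw [pairing_apply, pairing_apply, CliffordAlgebra.reverse.map_mul]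
  erw [CliffordAlgebra.reverse_ι]
  rw [mul_assoc]

theorem pairing_contr (X : Module.Dual ℝ E5) (φ ψ : Forms) :
    pairing (contr X φ) ψ = pairing φ (contr X ψ) := by
  induction φ using CliffordAlgebra.left_induction generalizing ψ with
  | algebraMap r =>
    have h : pairing 1 (contr X ψ) = 0 := by
      rw [pairing_apply, CliffordAlgebra.reverse.map_one, one_mul, topCoeff_contr]
    rw [Algebra.algebraMap_eq_smul_one, map_smul (contr X), contr_one, smul_zero, map_zero,
      map_smul pairing, LinearMap.smul_apply, h, LinearMap.zero_apply, smul_zero]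
  | add x y hx hy => simp only [map_add, LinearMap.add_apply, hx, hy]
  | ι_mul x m hx =>
    change pairing (contr X (ExteriorAlgebra.ι ℝ m * x)) ψ
      = pairing (ExteriorAlgebra.ι ℝ m * x) (contr X ψ)
    rw [contr_ι_mul, map_sub, map_smul, LinearMap.sub_apply, LinearMap.smul_apply, pairing_ι_mul,
      pairing_ι_mul, hx, contr_ι_mul, map_sub, map_smul]
    ring

/-- Clifford multiplication by a vector is self-adjoint for the pairing. -/
theorem pairing_vecAct (v : R10) (φ ψ : Forms) :
    pairing (vecAct v φ) ψ = pairing φ (vecAct v ψ) := by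
  rw [vecAct_apply, vecAct_apply, map_add, map_add, LinearMap.add_apply, pairing_ι_mul]
  congr 1
  exact pairing_contr _ _ _

/-! ### The vector attached to a pair of spinors -/

/-- The vector of `ℝ¹⁰` representing a functional through the polar form of `Q10`. -/
def vecOfDual : Module.Dual ℝ R10 →ₗ[ℝ] R10 where
  toFun f := (f ∘ₗ LinearMap.inr ℝ _ _, fun i => f (coord i, 0))
  map_add' f g := by ext <;> simp
  map_smul' r f := by ext <;> simp

theorem polar_vecOfDual (x : R10) (f : Module.Dual ℝ R10) :
    QuadraticMap.polar Q10 x (vecOfDual f) = f x := by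
  obtain ⟨X, ξ⟩ := x
  have h1 : X (fun i => f (coord i, 0)) = f (X, 0) := by
    have : (X, (0 : E5)) = ∑ i, X (Pi.single i 1) • (coord i, (0 : E5)) := by
      conv_lhs => rw [dual_eq_sum X]
      ext <;> simp [Prod.fst_sum, Prod.snd_sum]
    rw [this, map_sum]
    conv_lhs => rw [dual_eq_sum X]
    simp only [map_smul, LinearMap.sum_apply, LinearMap.smul_apply, LinearMap.proj_apply]
  have h2 : (X, ξ) = (X, 0) + ((0 : Module.Dual ℝ E5), ξ) := by simp
  rw [polar_Q10, h2, map_add]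
  simp [vecOfDual, h1]

/-- The polar form is nondegenerate. -/
theorem eq_of_polar_eq {a b : R10}
    (h : ∀ x, QuadraticMap.polar Q10 x a = QuadraticMap.polar Q10 x b) : a = b := by
  have h1 : ∀ x, QuadraticMap.polar Q10 x (a - b) = 0 := fun x => by
    rw [QuadraticMap.polar_sub_right, h, sub_self]
  rw [← sub_eq_zero]
  refine Prod.ext (LinearMap.ext fun m => ?_) (funext fun i => ?_)
  · simpa [polar_Q10] using h1 (0, m)
  · simpa [polar_Q10] using h1 (coord i, 0)

theorem exists_polar_eq_one {v : R10} (hv : v ≠ 0) : ∃ x, QuadraticMap.polar Q10 v x = 1 := by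
  by_contra! H
  refine hv (eq_of_polar_eq fun x => ?_)
  rw [QuadraticMap.polar_zero_right]
  by_contra hx
  refine H ((QuadraticMap.polar Q10 x v)⁻¹ • x) ?_
  rw [QuadraticMap.polar_smul_right, smul_eq_mul, QuadraticMap.polar_comm, inv_mul_cancel₀]
  rwa [QuadraticMap.polar_comm]

/-- The symmetric bilinear map `β` from spinors to vectors, with
`polar x β(φ, ψ) = ⟨x φ, ψ⟩ + ⟨x ψ, φ⟩`. -/
def spinorVec : Forms →ₗ[ℝ] Forms →ₗ[ℝ] R10 :=
  LinearMap.mk₂ ℝ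
    (fun φ ψ => vecOfDual ((pairing.flip ψ) ∘ₗ (vecAct.flip φ) + (pairing.flip φ) ∘ₗ (vecAct.flip ψ)))
    (fun φ φ' ψ => by
      simp only [map_add, LinearMap.comp_add, LinearMap.add_comp]; abel)
    (fun r φ ψ => by
      simp only [map_smul, map_add, LinearMap.comp_smul, LinearMap.smul_comp, smul_add])
    (fun φ ψ ψ' => by
      simp only [map_add, LinearMap.comp_add, LinearMap.add_comp]; abel)
    (fun r φ ψ => by
      simp only [map_smul, map_add, LinearMap.comp_smul, LinearMap.smul_comp, smul_add])

theorem polar_spinorVec (x : R10) (φ ψ : Forms) :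
    QuadraticMap.polar Q10 x (spinorVec φ ψ) =
      pairing (vecAct x φ) ψ + pairing (vecAct x ψ) φ := by
  rw [spinorVec, LinearMap.mk₂_apply, polar_vecOfDual]
  simp

theorem spinorVec_comm (φ ψ : Forms) : spinorVec φ ψ = spinorVec ψ φ :=
  eq_of_polar_eq fun x => by rw [polar_spinorVec, polar_spinorVec, add_comm]

/-- If `v` annihilates `φ` and `polar v x = 1`, then `φ = v x φ`, so `β(φ, φ)` is a multiple
of `v`. -/
theorem spinorVec_self_of_vecAct_eq_zero {v x : R10} {φ : Forms}
    (hx : QuadraticMap.polar Q10 v x = 1) (hφ : vecAct v φ = 0) :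
    spinorVec φ φ = (2 * pairing φ (vecAct x φ)) • v := by
  have h1 : vecAct v (vecAct x φ) = φ := by
    have := vecAct_anticomm v x φ
    rwa [hφ, map_zero, add_zero, hx, one_smul] at this
  refine eq_of_polar_eq fun y => ?_
  have h2 : pairing (vecAct y φ) φ = QuadraticMap.polar Q10 y v * pairing φ (vecAct x φ) := by
    have h3 := vecAct_anticomm v y φ
    rw [hφ, map_zero, add_zero] at h3
    have h4 : pairing (vecAct y φ) (vecAct v (vecAct x φ)) =
        pairing (vecAct v (vecAct y φ)) (vecAct x φ) := (pairing_vecAct _ _ _).symm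
    rw [h1] at h4
    rw [h4, h3, QuadraticMap.polar_comm]
    simp
  rw [polar_spinorVec, h2, QuadraticMap.polar_smul_right, smul_eq_mul]
  ring

/-- `β` intertwines reflections: `β(nφ, nψ) = polar n β(φ, ψ) n - Q(n) β(φ, ψ)`. -/
theorem spinorVec_vecAct (n : R10) (φ ψ : Forms) :
    spinorVec (vecAct n φ) (vecAct n ψ) =
      QuadraticMap.polar Q10 n (spinorVec φ ψ) • n - Q10 n • spinorVec φ ψ := by
  have h1 : ∀ x χ, vecAct n (vecAct x (vecAct n χ)) =
      vecAct (QuadraticMap.polar Q10 x n • n - Q10 n • x) χ := fun x χ => by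
    have := congrArg (vecAct n) (vecAct_anticomm x n χ)
    rw [map_add, vecAct_vecAct, map_smul] at this
    rw [eq_sub_of_add_eq this]
    simp
  refine eq_of_polar_eq fun x => ?_
  rw [polar_spinorVec, ← pairing_vecAct n, ← pairing_vecAct n, h1, h1, ← polar_spinorVec,
    QuadraticMap.polar_sub_left, QuadraticMap.polar_sub_right, QuadraticMap.polar_smul_left,
    QuadraticMap.polar_smul_left, QuadraticMap.polar_smul_right, QuadraticMap.polar_smul_right]
  simp only [smul_eq_mul]
  ring

/-! ### Every half-spinor satisfies `β(φ, φ) φ = 0` -/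

/-- Products of more than five vectors of `T*` vanish in the exterior algebra. -/
theorem exteriorPower_eq_bot {n : ℕ} (hn : 5 < n) : ⋀[ℝ]^n E5 = ⊥ := by
  rw [← ExteriorAlgebra.ιMulti_span_fixedDegree, Submodule.span_eq_bot]
  rintro _ ⟨v, rfl⟩
  refine AlternatingMap.map_linearDependent _ _ fun h => ?_
  have := h.fintype_card_le_finrank
  simp at this
  omega

/-- The volume form of `T*`. -/
def volForm : Forms := ExteriorAlgebra.ιMulti ℝ 5 fun i => (Pi.single i 1 : E5)

/-- Five-forms are multiples of the volume form, the coefficient being a determinant. -/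
theorem ιMulti_five (v : Fin 5 → E5) :
    ∃ r : ℝ, ExteriorAlgebra.ιMulti ℝ 5 v = r • volForm := by
  refine ⟨(Pi.basisFun ℝ (Fin 5)).det v, ?_⟩
  have h : (ExteriorAlgebra.ιMulti ℝ 5 : E5 [⋀^Fin 5]→ₗ[ℝ] Forms) =
      (LinearMap.toSpanSingleton ℝ Forms volForm).compAlternatingMap
        (Pi.basisFun ℝ (Fin 5)).det := by
    refine Module.Basis.ext_alternating (Pi.basisFun ℝ (Fin 5)) fun w hw => ?_
    obtain ⟨σ, rfl⟩ : ∃ σ : Equiv.Perm (Fin 5), w = σ :=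
      ⟨Equiv.ofBijective w (Finite.injective_iff_bijective.mp hw), rfl⟩
    rw [← Function.comp_def (Pi.basisFun ℝ (Fin 5)) σ, AlternatingMap.map_perm,
      AlternatingMap.map_perm]
    congr 1
    rw [LinearMap.compAlternatingMap_apply, Module.Basis.det_self, LinearMap.toSpanSingleton_apply,
      one_smul, volForm]
    congr 1
    funext i
    simp
  rw [h]
  simp

/-- In dimension five every four-form is a contraction of the volume form. -/
theorem exists_contr_volForm {c : Forms} (hc : c ∈ ⋀[ℝ]^4 E5) : ∃ Y, c = contr Y volForm := by
  suffices h : ⋀[ℝ]^4 E5 ≤ LinearMap.range ((CliffordAlgebra.contractLeft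
      (Q := (0 : QuadraticForm ℝ E5))).flip volForm) by
    obtain ⟨Y, hY⟩ := h hc
    exact ⟨Y, hY.symm⟩
  rw [← ExteriorAlgebra.ιMulti_span_fixedDegree, Submodule.span_le]
  rintro _ ⟨v, rfl⟩
  -- a vector `X ≠ 0` killed by the four covectors exists, since they do not span `T*`
  obtain ⟨X, hX, hv⟩ : ∃ X : Module.Dual ℝ E5, X ≠ 0 ∧
      Submodule.span ℝ (Set.range v) ≤ LinearMap.ker X := by
    refine Submodule.exists_le_ker_of_lt_top _ (lt_top_iff_ne_top.mpr fun h => ?_)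
    have := finrank_range_le_card (R := ℝ) v
    rw [Set.finrank, h, finrank_top] at this
    simp at this
  have hv0 : ∀ i, X (v i) = 0 := fun i => hv (Submodule.subset_span ⟨i, rfl⟩)
  obtain ⟨m, hm⟩ : ∃ m, X m = 1 := by
    obtain ⟨m, hm⟩ := DFunLike.ne_iff.mp hX
    exact ⟨(X m)⁻¹ • m, by simpa using inv_mul_cancel₀ hm⟩
  obtain ⟨r, hr⟩ := ιMulti_five (Fin.cons m v)
  -- with `X m = 1` and `X (v i) = 0`, contracting `m ∧ v₀ ∧ ⋯ ∧ v₃` by `X` gives `v₀ ∧ ⋯ ∧ v₃`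
  have h0 : ∀ {n : ℕ} (w : Fin n → E5), (∀ i, X (w i) = 0) →
      contr X (ExteriorAlgebra.ιMulti ℝ n w) = 0 := by
    intro n
    induction n with
    | zero => intro w _; rw [ExteriorAlgebra.ιMulti_zero_apply, contr_one]
    | succ n ih =>
      intro w hw
      rw [ExteriorAlgebra.ιMulti_succ_apply, contr_ι_mul, hw, ih (Matrix.vecTail w) fun i => hw _]
      simp
  refine ⟨r • X, ?_⟩
  change contr (r • X) volForm = _
  have h1 : contr (r • X) volForm = contr X (r • volForm) := by simp [contr]
  have h2 : Matrix.vecTail (Fin.cons m v : Fin 5 → E5) = v := rfl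
  rw [h1, ← hr, ExteriorAlgebra.ιMulti_succ_apply, contr_ι_mul, h2, h0 v hv0, Fin.cons_zero, hm,
    one_smul, mul_zero, sub_zero]

/-- For a two-form `b`: `i_X b` is a one-form, `b` commutes with one-forms, and `i_X` is a
derivation without sign on products with `b`. -/
theorem twoForm_properties {b : Forms} (hb : b ∈ ⋀[ℝ]^2 E5) (X : Module.Dual ℝ E5) :
    (∃ η, contr X b = ExteriorAlgebra.ι ℝ η) ∧
      (∀ η, b * ExteriorAlgebra.ι ℝ η = ExteriorAlgebra.ι ℝ η * b) ∧
      ∀ y, contr X (b * y) = contr X b * y + b * contr X y := by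
  rw [← ExteriorAlgebra.ιMulti_span_fixedDegree] at hb
  induction hb using Submodule.span_induction with
  | mem x hx =>
    obtain ⟨v, rfl⟩ := hx
    have h2 : ExteriorAlgebra.ιMulti ℝ 2 v =
        ExteriorAlgebra.ι ℝ (v 0) * ExteriorAlgebra.ι ℝ (v 1) := by
      simp [ExteriorAlgebra.ιMulti_apply, Matrix.vecTail]
    have hs := fun m n : E5 => eq_neg_of_add_eq_zero_left (ExteriorAlgebra.ι_add_mul_swap (R := ℝ) m n)
    rw [h2]
    refine ⟨⟨X (v 0) • v 1 - X (v 1) • v 0, ?_⟩, fun η => ?_, fun y => ?_⟩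
    · rw [contr_ι_mul, contr_ι, ← Algebra.commutes, ← Algebra.smul_def]
      simp
    · rw [mul_assoc, hs _ η, mul_neg, ← mul_assoc, hs _ η, neg_mul, neg_neg, mul_assoc]
    · rw [mul_assoc, contr_ι_mul, contr_ι_mul, contr_ι_mul, contr_ι, ← Algebra.commutes,
        ← Algebra.smul_def, mul_sub, sub_mul, smul_mul_assoc, smul_mul_assoc, mul_smul_comm,
        mul_assoc]
      abel
  | zero => exact ⟨⟨0, by simp⟩, by simp, by simp⟩
  | add x y _ _ hx hy =>
    obtain ⟨⟨η, h1⟩, h2, h3⟩ := hx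
    obtain ⟨⟨η', h1'⟩, h2', h3'⟩ := hy
    refine ⟨⟨η + η', by rw [map_add, map_add, h1, h1']⟩, fun η => ?_, fun z => ?_⟩
    · rw [add_mul, mul_add, h2, h2']
    · rw [add_mul, map_add, h3, h3', map_add, add_mul, add_mul]; abel
  | smul r x _ hx =>
    obtain ⟨⟨η, h1⟩, h2, h3⟩ := hx
    refine ⟨⟨r • η, by rw [map_smul, map_smul, h1]⟩, fun η => ?_, fun z => ?_⟩
    · rw [smul_mul_assoc, h2, mul_smul_comm]
    · rw [smul_mul_assoc, map_smul, h3, map_smul, smul_mul_assoc, smul_mul_assoc, smul_add]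

/-- Degrees add under the exterior product. -/
theorem exteriorPower_mul {i j : ℕ} {x y : Forms} (hx : x ∈ ⋀[ℝ]^i E5) (hy : y ∈ ⋀[ℝ]^j E5) :
    x * y ∈ ⋀[ℝ]^(i + j) E5 := by
  have := Submodule.mul_mem_mul hx hy
  rwa [← pow_add] at this

/-- An even form with nonzero scalar part `a` is `e^{b/a} (a + c')` with `c'` a four-form; as
`c' = i_Y vol`, it is annihilated by some `X ≠ 0`, and hence the original form
by `X - i_X b / a`. -/
theorem exists_annihilator {a : ℝ} {b c : Forms} (ha : a ≠ 0) (hb : b ∈ ⋀[ℝ]^2 E5)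
    (hc : c ∈ ⋀[ℝ]^4 E5) : ∃ v : R10, v ≠ 0 ∧ vecAct v (a • 1 + b + c) = 0 := by
  obtain ⟨Y, hY⟩ := exists_contr_volForm (Submodule.sub_mem _ hc
    (Submodule.smul_mem _ (2 * a)⁻¹ (exteriorPower_mul hb hb)))
  obtain ⟨X, hX, hXc⟩ : ∃ X : Module.Dual ℝ E5, X ≠ 0 ∧
      contr X (c - (2 * a)⁻¹ • (b * b)) = 0 := by
    by_cases h : Y = 0
    · refine ⟨coord 0, fun h0 => ?_, ?_⟩
      · simpa using LinearMap.congr_fun h0 (Pi.single 0 1)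
      · rw [hY, h]; simp [contr]
    · exact ⟨Y, h, by rw [hY, contr_contr]⟩
  obtain ⟨⟨η, h1⟩, h2, h3⟩ := twoForm_properties hb X
  have h6 : ∀ x ∈ ⋀[ℝ]^6 E5, x = 0 := fun x hx => by
    rwa [exteriorPower_eq_bot (by norm_num), Submodule.mem_bot] at hx
  -- the components of degree five vanish because `b ∧ b ∧ b` and `b ∧ c` have degree six
  have hbbb : b * (b * b) = 0 := h6 _ (exteriorPower_mul hb (exteriorPower_mul hb hb))
  have hbc : b * c = 0 := h6 _ (exteriorPower_mul hb hc)
  have hXc' : contr X c = a⁻¹ • (ExteriorAlgebra.ι ℝ η * b) := by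
    rw [map_sub, sub_eq_zero] at hXc
    rw [hXc, map_smul, h3, h1, h2, ← two_smul ℝ, smul_smul]
    congr 1
    field_simp
  have hηbb : ExteriorAlgebra.ι ℝ η * (b * b) = 0 := by
    have h := congrArg (contr X) hbbb
    rw [h3, h3, h1, h2, mul_add, ← mul_assoc b, h2, mul_assoc, map_zero] at h
    have h' : (3 : ℝ) • (ExteriorAlgebra.ι ℝ η * (b * b)) = 0 := by rw [← h]; module
    exact (smul_eq_zero.mp h').resolve_left (by norm_num)
  have hηc : ExteriorAlgebra.ι ℝ η * c = 0 := by
    have h := congrArg (contr X) hbc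
    rw [h3, h1, hXc', mul_smul_comm, ← mul_assoc b, h2, mul_assoc, hηbb, smul_zero, add_zero,
      map_zero] at h
    exact h
  refine ⟨(X, -a⁻¹ • η), fun h => hX (congrArg Prod.fst h), ?_⟩
  change contr X _ + ExteriorAlgebra.ι ℝ (-a⁻¹ • η) * _ = 0
  rw [map_add, map_add, map_smul, contr_one, h1, hXc', map_smul, smul_mul_assoc, mul_add, mul_add,
    hηc, mul_smul_comm, mul_one, smul_add, smul_add, smul_smul, neg_mul, inv_mul_cancel₀ ha]
  module

/-- An even form is a sum of forms of degrees zero, two and four. -/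
theorem exists_components {φ : Forms} (hφ : φ ∈ HalfSpin 0) :
    ∃ (a : ℝ) (b c : Forms), b ∈ ⋀[ℝ]^2 E5 ∧ c ∈ ⋀[ℝ]^4 E5 ∧ φ = a • 1 + b + c := by
  have h : HalfSpin 0 ≤ 1 ⊔ ⋀[ℝ]^2 E5 ⊔ ⋀[ℝ]^4 E5 := by
    refine iSup_le fun ⟨n, hn⟩ => ?_
    change ⋀[ℝ]^n E5 ≤ _
    rcases lt_or_ge 5 n with h5 | h5
    · rw [exteriorPower_eq_bot h5]; exact bot_le
    · interval_cases n
      · rw [show ⋀[ℝ]^0 E5 = 1 from pow_zero _]; exact le_sup_left.trans le_sup_left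
      · exact absurd hn (by decide)
      · exact le_sup_right.trans le_sup_left
      · exact absurd hn (by decide)
      · exact le_sup_right
      · exact absurd hn (by decide)
  obtain ⟨x, hx, c, hc, rfl⟩ := Submodule.mem_sup.mp (h hφ)
  obtain ⟨y, hy, b, hb, rfl⟩ := Submodule.mem_sup.mp hx
  obtain ⟨a, rfl⟩ := Submodule.mem_one.mp hy
  exact ⟨a, b, c, hb, hc, by rw [Algebra.algebraMap_eq_smul_one]⟩

theorem spinorVec_act_self_of_annihilator {v : R10} {φ : Forms} (hv : v ≠ 0)
    (hφ : vecAct v φ = 0) : vecAct (spinorVec φ φ) φ = 0 := by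
  obtain ⟨x, hx⟩ := exists_polar_eq_one hv
  rw [spinorVec_self_of_vecAct_eq_zero hx hφ, map_smul, LinearMap.smul_apply, hφ, smul_zero]

/-- The cubic identity for even forms. If the scalar part vanishes, it follows from the values
of the cubic polynomial `t ↦ β(φ + t, φ + t) (φ + t)` at `t = ±1, ±2`. -/
theorem spinorVec_act_self_even {φ : Forms} (hφ : φ ∈ HalfSpin 0) :
    vecAct (spinorVec φ φ) φ = 0 := by
  obtain ⟨a, b, c, hb, hc, rfl⟩ := exists_components hφ
  have key : ∀ t : ℝ, t ≠ 0 →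
      vecAct (spinorVec (t • 1 + b + c) (t • 1 + b + c)) (t • 1 + b + c) = 0 := fun t ht => by
    obtain ⟨v, hv, h⟩ := exists_annihilator ht hb hc
    exact spinorVec_act_self_of_annihilator hv h
  by_cases ha : a = 0
  · subst ha
    -- the constant term of a cubic from its values at `±1` and `±2`
    simp only [add_assoc] at key ⊢
    generalize b + c = x at key ⊢
    have h1 := key 1 (by norm_num)
    have h2 := key (-1) (by norm_num)
    have h3 := key 2 (by norm_num)
    have h4 := key (-2) (by norm_num)
    simp only [map_add, LinearMap.add_apply, map_smul, LinearMap.smul_apply, smul_add, zero_smul,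
      zero_add] at h1 h2 h3 h4 ⊢
    linear_combination (norm := module) (2 / 3 : ℝ) • h1 + (2 / 3 : ℝ) • h2 - (1 / 6 : ℝ) • h3
      - (1 / 6 : ℝ) • h4
  · exact key a ha

/-- A vector `n` with `Q(n) = 1`; it exchanges the two half-spin representations. -/
def unitVec : R10 := (coord 0, Pi.single 0 1)

theorem Q10_unitVec : Q10 unitVec = 1 := by
  simp [unitVec, QuadraticForm.dualProd_apply]

/-- The cubic identity `β(φ, φ) φ = 0` for half-spinors. -/
theorem spinorVec_act_self {p : ZMod 2} {φ : Forms} (hφ : φ ∈ HalfSpin p) :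
    vecAct (spinorVec φ φ) φ = 0 := by
  obtain rfl | rfl := (by decide : ∀ q : ZMod 2, q = 0 ∨ q = 1) p
  · exact spinorVec_act_self_even hφ
  -- the reflected spinor `n φ` is even, and `β(nφ, nφ) n φ = n β(φ, φ) φ`
  · have h0 : vecAct unitVec φ ∈ HalfSpin 0 := by
      have := vecAct_mem unitVec hφ
      rwa [show (1 : ZMod 2) + 1 = 0 from by decide] at this
    have h1 := spinorVec_act_self_even h0
    have h2 := vecAct_anticomm unitVec (spinorVec φ φ) φ
    rw [spinorVec_vecAct, Q10_unitVec, map_sub, map_smul, LinearMap.sub_apply, LinearMap.smul_apply,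
      vecAct_vecAct, Q10_unitVec, one_smul, one_smul, ← h2, add_sub_cancel_right] at h1
    have h3 := congrArg (vecAct unitVec) h1
    rwa [vecAct_vecAct, Q10_unitVec, one_smul, map_zero] at h3

/-! ### Orthonormal frames and signature -/

section Orthonormal

variable {M : Type*} [AddCommGroup M] [Module ℝ M] {q : QuadraticForm ℝ M} {e : Fin 3 → M}

/-- Orthonormality for a form of signature `(2, 1)`. -/
def IsOrthonormal21 (q : QuadraticForm ℝ M) (e : Fin 3 → M) : Prop :=
  (∀ i j, i ≠ j → QuadraticMap.polar q (e i) (e j) = 0) ∧ q (e 0) = 1 ∧ q (e 1) = 1 ∧ q (e 2) = -1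

namespace IsOrthonormal21

theorem apply (he : IsOrthonormal21 q e) (k : Fin 3) : q (e k) = (![1, 1, -1] : Fin 3 → ℝ) k := by
  obtain ⟨-, h0, h1, h2⟩ := he
  fin_cases k
  · exact h0
  · exact h1
  · exact h2

theorem ne_zero (he : IsOrthonormal21 q e) (k : Fin 3) : q (e k) ≠ 0 := by
  rw [he.apply]
  fin_cases k <;> norm_num

theorem polar_sum (he : IsOrthonormal21 q e) (t : Fin 3 → ℝ) (k : Fin 3) :
    QuadraticMap.polar q (∑ i, t i • e i) (e k) = 2 * t k * q (e k) := by
  have h : QuadraticMap.polar q (∑ i, t i • e i) (e k) =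
      ∑ i, t i * QuadraticMap.polar q (e i) (e k) := by
    simp only [Fin.sum_univ_three, QuadraticMap.polar_add_left, QuadraticMap.polar_smul_left,
      smul_eq_mul]
  rw [h, Finset.sum_eq_single k (fun i _ hi => by rw [he.1 i k hi, mul_zero]) (by simp),
    QuadraticMap.polar_self]
  simp only [nsmul_eq_mul]
  push_cast
  ring

theorem linearIndependent (he : IsOrthonormal21 q e) : LinearIndependent ℝ e := by
  rw [Fintype.linearIndependent_iff]
  intro t ht k
  have h := he.polar_sum t k
  rw [ht, QuadraticMap.polar_zero_left] at h
  simpa [he.ne_zero k] using h.symm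

theorem exists_basis (he : IsOrthonormal21 q e) (hM : Module.finrank ℝ M = 3) :
    ∃ b : Module.Basis (Fin 3) ℝ M, ∀ i, b i = e i :=
  ⟨basisOfLinearIndependentOfCardEqFinrank he.linearIndependent (by simp [hM]), fun i => by simp⟩

theorem hasSignature (he : IsOrthonormal21 q e) (hM : Module.finrank ℝ M = 3) :
    HasSignature q 2 1 := by
  obtain ⟨b, hb⟩ := he.exists_basis hM
  have hE : QuadraticMap.Equivalent q
      (QuadraticMap.weightedSumSquares ℝ (![1, 1, -1] : Fin 3 → ℝ)) := by
    have h1 := QuadraticMap.basisRepr_eq_of_iIsOrtho q b (by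
      intro i j hij
      have h2 := he.1 i j hij
      rw [QuadraticMap.polar] at h2
      simp [Function.onFun, QuadraticMap.associated_apply, hb, h2])
    rw [show (fun i => q (b i)) = (![1, 1, -1] : Fin 3 → ℝ) from
      funext fun i => by rw [hb, he.apply]] at h1
    rw [← h1]
    exact ⟨QuadraticMap.isometryEquivBasisRepr _ _⟩
  refine ⟨hM, ?_, ?_⟩
  · rw [QuadraticForm.sigPos_of_equiv_weightedSumSquares hE]
    have : {i : Fin 3 | 0 < (![1, 1, -1] : Fin 3 → ℝ) i} = {0, 1} := by
      ext i; fin_cases i <;> simp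
    rw [this, Set.ncard_pair (by decide)]
  · rw [QuadraticForm.sigNeg_of_equiv_weightedSumSquares hE]
    have : {i : Fin 3 | (![1, 1, -1] : Fin 3 → ℝ) i < 0} = {2} := by
      ext i; fin_cases i <;> simp
    rw [this, Set.ncard_singleton]

/-- A space spanned by three vectors and containing an orthonormal frame is
three-dimensional. -/
theorem finrank_span (he : IsOrthonormal21 q e) {u w z : M}
    (hspan : ∀ i, e i ∈ Submodule.span ℝ {u, w, z}) :
    Module.finrank ℝ (Submodule.span ℝ {u, w, z}) = 3 := by
  have hfin : ({u, w, z} : Set M).Finite := Set.toFinite _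
  have : FiniteDimensional ℝ (Submodule.span ℝ {u, w, z}) := FiniteDimensional.span_of_finite ℝ hfin
  refine le_antisymm ?_ ?_
  · classical
    have h := finrank_span_finset_le_card (R := ℝ) ({u, w, z} : Finset M)
    rw [Set.finrank, show ((({u, w, z} : Finset M) : Set M)) = {u, w, z} by push_cast; rfl] at h
    exact h.trans Finset.card_le_three
  · have h := finrank_span_eq_card he.linearIndependent
    rw [Fintype.card_fin] at h
    rw [← h]
    refine Submodule.finrank_mono (Submodule.span_le.mpr ?_)
    rintro _ ⟨i, rfl⟩
    exact hspan i

end IsOrthonormal21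

/-- A form of signature `(2, 1)` admits an orthonormal frame. -/
theorem exists_isOrthonormal21 (h : HasSignature q 2 1) : ∃ e, IsOrthonormal21 q e := by
  obtain ⟨hM, hp, hn⟩ := h
  have : FiniteDimensional ℝ M := Module.finite_of_finrank_pos (by omega)
  obtain ⟨s, hs⟩ := QuadraticForm.equivalent_signType_weighted_sum_squared q
  rw [QuadraticForm.sigPos_of_equiv_weightedSumSquares hs] at hp
  rw [QuadraticForm.sigNeg_of_equiv_weightedSumSquares hs] at hn
  obtain ⟨f⟩ := hs
  obtain ⟨i, j, hij, hP⟩ := Set.ncard_eq_two.mp hp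
  obtain ⟨k, hN⟩ := Set.ncard_eq_one.mp hn
  have hs1 : ∀ l, 0 < (s l : ℝ) → (s l : ℝ) = 1 := fun l => by cases s l <;> simp
  have hs2 : ∀ l, (s l : ℝ) < 0 → (s l : ℝ) = -1 := fun l => by cases s l <;> simp
  have hi : (s i : ℝ) = 1 := hs1 i (by change i ∈ {i | 0 < (s i : ℝ)}; rw [hP]; simp)
  have hj : (s j : ℝ) = 1 := hs1 j (by change j ∈ {i | 0 < (s i : ℝ)}; rw [hP]; simp)
  have hk : (s k : ℝ) = -1 := hs2 k (by change k ∈ {i | (s i : ℝ) < 0}; rw [hN]; simp)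
  have hik : i ≠ k := fun h => by rw [h, hk] at hi; norm_num at hi
  have hjk : j ≠ k := fun h => by rw [h, hk] at hj; norm_num at hj
  have hQ : ∀ x, q (f.symm x) =
      QuadraticMap.weightedSumSquares ℝ (fun i => (s i : ℝ)) x := fun x => f.symm.map_app x
  let b : Fin 3 → Fin (Module.finrank ℝ M) := ![i, j, k]
  have hb : ∀ m n, m ≠ n → b m ≠ b n := by
    intro m n hmn
    fin_cases m <;> fin_cases n <;> simp_all [b, Ne.symm]
  have hsq : ∀ m, q (f.symm (Pi.single m 1)) = s m := fun m => by
    rw [hQ, QuadraticMap.weightedSumSquares_apply]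
    simp [Pi.single_apply]
  refine ⟨fun m => f.symm (Pi.single (b m) 1), fun m n hmn => ?_, (hsq _).trans hi,
    (hsq _).trans hj, (hsq _).trans hk⟩
  rw [QuadraticMap.polar, hsq, hsq, ← map_add, hQ, QuadraticMap.weightedSumSquares_apply]
  have h1 : ∀ l, (s l : ℝ) • ((Pi.single (b m) 1 + Pi.single (b n) 1 : _ → ℝ) l *
      (Pi.single (b m) 1 + Pi.single (b n) 1 : _ → ℝ) l) =
      (if l = b m then (s l : ℝ) else 0) + if l = b n then (s l : ℝ) else 0 := fun l => by
    by_cases h1 : l = b m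
    · subst h1; simp [hb m n hmn]
    · by_cases h2 : l = b n
      · subst h2; simp [(hb m n hmn).symm]
      · simp [h1, h2]
  rw [Finset.sum_congr rfl fun l _ => h1 l, Finset.sum_add_distrib]
  simp

/-- A linear map `A` into traceless matrices with `A(v)² = q(v)` is an isomorphism onto
`sl(2, ℝ)`: a vector of the kernel is orthogonal to everything. -/
theorem exists_sl_equiv (he : IsOrthonormal21 q e) (hM : Module.finrank ℝ M = 3)
    (A : M →ₗ[ℝ] Matrix (Fin 2) (Fin 2) ℝ) (htr : ∀ v, (A v).trace = 0)
    (hsq : ∀ v, A v * A v = q v • 1) :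
    ∃ a : M ≃ₗ[ℝ] LieAlgebra.SpecialLinear.sl (Fin 2) ℝ, ∀ v,
      (a v : Matrix (Fin 2) (Fin 2) ℝ) = A v := by
  have hq : ∀ v w, A v = A w → q v = q w := fun v w h => by
    have h1 := hsq v
    rw [h, hsq w] at h1
    simpa using (congrFun (congrFun h1 0) 0).symm
  let a : M →ₗ[ℝ] LieAlgebra.SpecialLinear.sl (Fin 2) ℝ :=
    { toFun := fun v => ⟨A v, htr v⟩
      map_add' := fun v w => Subtype.ext (map_add A v w)
      map_smul' := fun r v => Subtype.ext (map_smul A r v) }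
  have hinj : Function.Injective a := by
    rw [← LinearMap.ker_eq_bot, LinearMap.ker_eq_bot']
    intro v hv
    have hAv : A v = 0 := congrArg Subtype.val hv
    obtain ⟨b, hb⟩ := he.exists_basis hM
    have hsum := b.sum_repr v
    simp only [hb] at hsum
    rw [← hsum]
    refine Finset.sum_eq_zero fun k _ => ?_
    have h1 := he.polar_sum (b.repr v) k
    rw [hsum, QuadraticMap.polar, hq (v + e k) (e k) (by rw [map_add, hAv, zero_add]),
      hq v 0 (by rw [hAv, map_zero]), QuadraticMap.map_zero] at h1
    have h2 : b.repr v k = 0 := by simpa [he.ne_zero k] using h1.symm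
    rw [h2, zero_smul]
  -- three entries determine a traceless matrix, so `sl(2, ℝ)` has dimension at most three
  let c : LieAlgebra.SpecialLinear.sl (Fin 2) ℝ →ₗ[ℝ] Fin 3 → ℝ :=
    { toFun := fun x => ![x.1 0 0, x.1 0 1, x.1 1 0]
      map_add' := fun x y => by ext i; fin_cases i <;> rfl
      map_smul' := fun r x => by ext i; fin_cases i <;> rfl }
  have hc : Function.Injective c := by
    rw [← LinearMap.ker_eq_bot, LinearMap.ker_eq_bot']
    intro x hx
    have h0 : x.1 0 0 = 0 := congrFun hx 0
    have h1 : x.1 0 1 = 0 := congrFun hx 1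
    have h2 : x.1 1 0 = 0 := congrFun hx 2
    have h3 : x.1.trace = 0 := x.2
    rw [Matrix.trace_fin_two, h0, zero_add] at h3
    refine Subtype.ext ?_
    ext i j
    fin_cases i <;> fin_cases j
    · exact h0
    · exact h1
    · exact h2
    · exact h3
  have : FiniteDimensional ℝ M := Module.finite_of_finrank_pos (by omega)
  have hsurj : Function.Surjective (c ∘ₗ a) :=
    (LinearMap.injective_iff_surjective_of_finrank_eq_finrank (by simp [hM])).mp (hc.comp hinj)
  have hsurj' : Function.Surjective a := fun x => by
    obtain ⟨v, hv⟩ := hsurj (c x)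
    exact ⟨v, hc hv⟩
  exact ⟨LinearEquiv.ofBijective a ⟨hinj, hsurj'⟩, fun v => rfl⟩

end Orthonormal

/-- A frame of `V` is an orthonormal triple for the restricted form. -/
theorem IsFrame.isOrthonormal21 {q : QuadraticForm ℝ R10} {V : Submodule ℝ R10}
    {e : Fin 3 → R10} (he : IsFrame q V e) :
    IsOrthonormal21 (M := V) (q.restrict V) fun i => ⟨e i, he.1 i⟩ :=
  he.2

/-! ### The three vectors of a pair of spinors -/

/-- The relations between two spinors `φ, ψ` and the vectors `u = β(φ, φ)`, `w = β(φ, ψ)`,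
`z = β(ψ, ψ)` in the nondegenerate case `c = polar u z ≠ 0`. -/
structure IsSpinorTriple (φ ψ : Forms) (u w z : R10) (c : ℝ) : Prop where
  ne_zero : c ≠ 0
  act_uφ : vecAct u φ = 0
  act_wφ : vecAct w φ = (-1 / 2 : ℝ) • vecAct u ψ
  act_wψ : vecAct w ψ = (-1 / 2 : ℝ) • vecAct z φ
  act_zψ : vecAct z ψ = 0
  Q_u : Q10 u = 0
  Q_w : Q10 w = -c / 4
  Q_z : Q10 z = 0
  polar_uw : QuadraticMap.polar Q10 u w = 0
  polar_uz : QuadraticMap.polar Q10 u z = c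
  polar_wz : QuadraticMap.polar Q10 w z = 0
  indep : ∀ s t : ℝ, s • φ + t • ψ = 0 → s = 0 ∧ t = 0

/-- The polarized cubic identities for two half-spinors. -/
theorem spinorVec_relations {p : ZMod 2} {φ ψ : Forms} (hφ : φ ∈ HalfSpin p)
    (hψ : ψ ∈ HalfSpin p) :
    vecAct (spinorVec φ ψ) φ = (-1 / 2 : ℝ) • vecAct (spinorVec φ φ) ψ ∧
      vecAct (spinorVec φ ψ) ψ = (-1 / 2 : ℝ) • vecAct (spinorVec ψ ψ) φ := by
  have h1 := spinorVec_act_self hφ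
  have h2 := spinorVec_act_self hψ
  have h3 := spinorVec_act_self (Submodule.add_mem _ hφ hψ)
  have h4 := spinorVec_act_self (Submodule.sub_mem _ hφ hψ)
  simp only [map_add, map_sub, LinearMap.add_apply, LinearMap.sub_apply, h1, h2,
    spinorVec_comm ψ φ] at h3 h4
  constructor
  · linear_combination (norm := module) (1 / 4 : ℝ) • h3 - (1 / 4 : ℝ) • h4
  · linear_combination (norm := module) (1 / 4 : ℝ) • h3 + (1 / 4 : ℝ) • h4

theorem isSpinorTriple {p : ZMod 2} {φ ψ : Forms} (hφ : φ ∈ HalfSpin p) (hψ : ψ ∈ HalfSpin p)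
    (hc : QuadraticMap.polar Q10 (spinorVec φ φ) (spinorVec ψ ψ) ≠ 0) :
    IsSpinorTriple φ ψ (spinorVec φ φ) (spinorVec φ ψ) (spinorVec ψ ψ)
      (QuadraticMap.polar Q10 (spinorVec φ φ) (spinorVec ψ ψ)) := by
  obtain ⟨hw1, hw2⟩ := spinorVec_relations hφ hψ
  have h1 := spinorVec_act_self hφ
  have h2 := spinorVec_act_self hψ
  have huψ : vecAct (spinorVec φ φ) ψ ≠ 0 := fun h => hc (by rw [polar_spinorVec, h]; simp)
  have hzφ : vecAct (spinorVec ψ ψ) φ ≠ 0 := fun h => hc (by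
    rw [QuadraticMap.polar_comm, polar_spinorVec, h]; simp)
  have hφ0 : φ ≠ 0 := fun h => hzφ (by rw [h, map_zero])
  have hψ0 : ψ ≠ 0 := fun h => huψ (by rw [h, map_zero])
  generalize spinorVec φ φ = u at *
  generalize spinorVec φ ψ = w at *
  generalize spinorVec ψ ψ = z at *
  generalize hcc : QuadraticMap.polar Q10 u z = c at *
  have cancel : ∀ {r : ℝ} {χ : Forms}, χ ≠ 0 → r • χ = 0 → r = 0 :=
    fun hχ h => (smul_eq_zero.mp h).resolve_right hχ
  have hQu : Q10 u = 0 := cancel hφ0 (by rw [← vecAct_vecAct, h1, map_zero])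
  have hQz : Q10 z = 0 := cancel hψ0 (by rw [← vecAct_vecAct, h2, map_zero])
  have huw : QuadraticMap.polar Q10 u w = 0 := cancel hφ0 (by
    rw [← vecAct_anticomm, h1, hw1, map_smul, vecAct_vecAct, hQu]; simp)
  have hwz : QuadraticMap.polar Q10 w z = 0 := cancel hψ0 (by
    rw [← vecAct_anticomm, h2, hw2, map_smul, vecAct_vecAct, hQz]; simp)
  refine ⟨hc, h1, hw1, hw2, h2, hQu, ?_, hQz, huw, hcc, hwz, fun s t h => ?_⟩
  · rw [← sub_eq_zero]
    refine cancel hφ0 ?_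
    have e1 := vecAct_vecAct w φ
    have e2 := vecAct_anticomm u w ψ
    have e3 := vecAct_anticomm u z φ
    rw [hw1, map_smul] at e1
    rw [huw, hw2, map_smul] at e2
    rw [h1, map_zero, hcc] at e3
    linear_combination (norm := module) -e1 - (1 / 2 : ℝ) • e2 - (1 / 4 : ℝ) • e3
  · constructor
    · have h' := congrArg (vecAct z) h
      rw [map_add, map_smul, map_smul, h2, smul_zero, add_zero, map_zero] at h'
      exact cancel hzφ h'
    · have h' := congrArg (vecAct u) h
      rw [map_add, map_smul, map_smul, h1, smul_zero, zero_add, map_zero] at h'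
      exact cancel huψ h'

/-! ### The volume element of an orthogonal triple -/

section VolumeElement

variable {e : Fin 3 → R10}

theorem cliffAct_volElt (e : Fin 3 → R10) (χ : Forms) :
    cliffAct (volElt e) χ = vecAct (e 0) (vecAct (e 1) (vecAct (e 2) χ)) := by
  simp [cliffAct, volElt]

theorem vecAct_swap {v w : R10} (h : QuadraticMap.polar Q10 v w = 0) (χ : Forms) :
    vecAct w (vecAct v χ) = -vecAct v (vecAct w χ) := by
  have := vecAct_anticomm w v χ
  rw [QuadraticMap.polar_comm, h, zero_smul] at this
  exact eq_neg_of_add_eq_zero_left this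

variable (he : ∀ i j, i ≠ j → QuadraticMap.polar Q10 (e i) (e j) = 0)
include he

/-- `ω e₁ e₂ = -Q(e₁) Q(e₂) e₀`, one of three cyclic relations. -/
theorem volElt_bivector_12 (χ : Forms) : cliffAct (volElt e) (vecAct (e 1) (vecAct (e 2) χ)) =
    -(Q10 (e 1) * Q10 (e 2)) • vecAct (e 0) χ := by
  simp only [cliffAct_volElt, vecAct_swap (he 1 2 (by decide)), map_neg, map_smul, vecAct_vecAct]
  module

theorem volElt_bivector_20 (χ : Forms) : cliffAct (volElt e) (vecAct (e 2) (vecAct (e 0) χ)) =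
    -(Q10 (e 2) * Q10 (e 0)) • vecAct (e 1) χ := by
  simp only [cliffAct_volElt, vecAct_swap (he 0 1 (by decide)), vecAct_swap (he 0 2 (by decide)),
    map_neg, map_smul, vecAct_vecAct, neg_neg]
  module

theorem volElt_bivector_01 (χ : Forms) : cliffAct (volElt e) (vecAct (e 0) (vecAct (e 1) χ)) =
    -(Q10 (e 0) * Q10 (e 1)) • vecAct (e 2) χ := by
  simp only [cliffAct_volElt, vecAct_swap (he 0 1 (by decide)), vecAct_swap (he 0 2 (by decide)),
    vecAct_swap (he 1 2 (by decide)), map_neg, map_smul, vecAct_vecAct, neg_neg]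
  module

/-- In an odd number of dimensions the volume element commutes with the vectors. -/
theorem volElt_comm (k : Fin 3) (χ : Forms) :
    vecAct (e k) (cliffAct (volElt e) χ) = cliffAct (volElt e) (vecAct (e k) χ) := by
  fin_cases k <;>
  simp only [Fin.mk_zero, Fin.mk_one, Fin.reduceFinMk, cliffAct_volElt,
    vecAct_swap (he 0 1 (by decide)), vecAct_swap (he 0 2 (by decide)),
    vecAct_swap (he 1 2 (by decide)), map_neg, map_smul, vecAct_vecAct, neg_neg]

theorem volElt_volElt (χ : Forms) : cliffAct (volElt e) (cliffAct (volElt e) χ) =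
    -(Q10 (e 0) * Q10 (e 1) * Q10 (e 2)) • χ := by
  simp only [cliffAct_volElt, vecAct_swap (he 0 1 (by decide)), vecAct_swap (he 0 2 (by decide)),
    vecAct_swap (he 1 2 (by decide)), map_neg, map_smul, vecAct_vecAct, neg_neg]
  module

end VolumeElement

/-! ### Existence -/

/-- The matrix by which the product of the vectors with coordinates `x`, `y` in `u, w, z` acts on
the pair `φ, ψ`. -/
def bivectorMatrix (c : ℝ) (x y : Fin 3 → ℝ) : Matrix (Fin 2) (Fin 2) ℝ :=
  !![c * (x 0 * y 2) - c / 4 * (x 1 * y 1), c / 2 * (x 1 * y 2 - x 2 * y 1);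
    c / 2 * (x 1 * y 0 - x 0 * y 1), c * (x 2 * y 0) - c / 4 * (x 1 * y 1)]

namespace IsSpinorTriple

variable {φ ψ : Forms} {u w z : R10} {c : ℝ}

theorem act_act (h : IsSpinorTriple φ ψ u w z c) (x y : Fin 3 → ℝ) :
    vecAct (x 0 • u + x 1 • w + x 2 • z) (vecAct (y 0 • u + y 1 • w + y 2 • z) φ) =
        bivectorMatrix c x y 0 0 • φ + bivectorMatrix c x y 0 1 • ψ ∧
      vecAct (x 0 • u + x 1 • w + x 2 • z) (vecAct (y 0 • u + y 1 • w + y 2 • z) ψ) =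
        bivectorMatrix c x y 1 0 • φ + bivectorMatrix c x y 1 1 • ψ := by
  have huz : vecAct u (vecAct z φ) = c • φ := by
    have := vecAct_anticomm u z φ
    rwa [h.act_uφ, map_zero, add_zero, h.polar_uz] at this
  have hzu : vecAct z (vecAct u ψ) = c • ψ := by
    have := vecAct_anticomm u z ψ
    rwa [h.act_zψ, map_zero, zero_add, h.polar_uz] at this
  have hwu : vecAct w (vecAct u ψ) = (c / 2) • φ := by
    rw [vecAct_swap h.polar_uw, h.act_wψ, map_smul, huz]; module
  have hwz : vecAct w (vecAct z φ) = (c / 2) • ψ := by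
    rw [vecAct_swap ((QuadraticMap.polar_comm _ _ _).trans h.polar_wz), h.act_wφ, map_smul, hzu]
    module
  have huu : vecAct u (vecAct u ψ) = 0 := by rw [vecAct_vecAct, h.Q_u, zero_smul]
  have hzz : vecAct z (vecAct z φ) = 0 := by rw [vecAct_vecAct, h.Q_z, zero_smul]
  constructor <;>
  simp only [map_add, map_smul, LinearMap.add_apply, LinearMap.smul_apply, h.act_uφ, h.act_wφ,
    h.act_wψ, h.act_zψ, huz, hzu, hwu, hwz, huu, hzz, map_zero, bivectorMatrix,
    Matrix.of_apply, Matrix.cons_val', Matrix.cons_val_zero, Matrix.cons_val_one,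
    Matrix.cons_val_fin_one] <;>
  module

theorem trace_bivectorMatrix (h : IsSpinorTriple φ ψ u w z c) (x y : Fin 3 → ℝ) :
    (bivectorMatrix c x y).trace = QuadraticMap.polar Q10 (x 0 • u + x 1 • w + x 2 • z)
      (y 0 • u + y 1 • w + y 2 • z) := by
  have h1 := (QuadraticMap.polar_comm Q10 w u).trans h.polar_uw
  have h2 := (QuadraticMap.polar_comm Q10 z u).trans h.polar_uz
  have h3 := (QuadraticMap.polar_comm Q10 z w).trans h.polar_wz
  simp only [QuadraticMap.polar_add_left, QuadraticMap.polar_add_right,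
    QuadraticMap.polar_smul_left, QuadraticMap.polar_smul_right, QuadraticMap.polar_self, h.Q_u,
    h.Q_w, h.Q_z, h.polar_uw, h.polar_uz, h.polar_wz, h1, h2, h3, smul_eq_mul,
    bivectorMatrix, Matrix.trace_fin_two_of, nsmul_eq_mul]
  push_cast
  ring

/-- Up to sign the quadratic form has signature `(2, 1)` on the span of `u, w, z`. -/
theorem exists_isFrame (h : IsSpinorTriple φ ψ u w z c) :
    ∃ (ε : ℝ) (q : QuadraticForm ℝ R10), ε * ε = 1 ∧ (q = Q10 ∨ q = -Q10) ∧
      (∀ v, Q10 v = ε * q v) ∧ ∃ e, IsFrame q (Submodule.span ℝ {u, w, z}) e := by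
  obtain ⟨ε, q, hε, hεc, hq, hqε⟩ : ∃ (ε : ℝ) (q : QuadraticForm ℝ R10), ε * ε = 1 ∧
      ε * c < 0 ∧ (q = Q10 ∨ q = -Q10) ∧ ∀ v, q v = ε * Q10 v := by
    rcases lt_or_gt_of_ne h.ne_zero with hc | hc
    · exact ⟨1, Q10, by norm_num, by linarith, Or.inl rfl, fun v => by ring⟩
    · exact ⟨-1, -Q10, by norm_num, by linarith, Or.inr rfl, fun v => by
        rw [_root_.neg_apply]; ring⟩
  have hpol : ∀ v v', QuadraticMap.polar q v v' = ε * QuadraticMap.polar Q10 v v' := fun v v' => by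
    simp only [QuadraticMap.polar, hqε]; ring
  have hu : u ∈ Submodule.span ℝ {u, w, z} := Submodule.subset_span (by simp)
  have hw : w ∈ Submodule.span ℝ {u, w, z} := Submodule.subset_span (by simp)
  have hz : z ∈ Submodule.span ℝ {u, w, z} := Submodule.subset_span (by simp)
  have hc := h.ne_zero
  have h1 := (QuadraticMap.polar_comm Q10 w u).trans h.polar_uw
  have h2 := (QuadraticMap.polar_comm Q10 z u).trans h.polar_uz
  have h3 := (QuadraticMap.polar_comm Q10 z w).trans h.polar_wz
  -- `Q(w) = -c / 4` and `Q(u + r z) = r c`; the orthonormal frame is a multiple of `w` and the two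
  -- vectors `u ± (ε / c) z`
  obtain ⟨s, hs0, hs⟩ : ∃ s : ℝ, s ≠ 0 ∧ s * s = -(ε * c) :=
    ⟨√(-(ε * c)), (Real.sqrt_pos.mpr (by linarith)).ne', Real.mul_self_sqrt (by linarith)⟩
  have hQadd : ∀ r : ℝ, Q10 (u + r • z) = r * c := fun r => by
    rw [QuadraticMap.map_add Q10, QuadraticMap.map_smul, h.Q_u, h.Q_z,
      QuadraticMap.polar_smul_right, h.polar_uz, smul_eq_mul, smul_eq_mul]
    ring
  refine ⟨ε, q, hε, hq, fun v => by rw [hqε, ← mul_assoc, hε, one_mul],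
    ![(2 / s) • w, u + (ε / c) • z, u + (-ε / c) • z], ?_, ?_, ?_, ?_, ?_⟩
  · intro i
    fin_cases i
    · exact Submodule.smul_mem _ _ hw
    · exact Submodule.add_mem _ hu (Submodule.smul_mem _ _ hz)
    · exact Submodule.add_mem _ hu (Submodule.smul_mem _ _ hz)
  · have p01 : ∀ r t : ℝ, QuadraticMap.polar q (r • w) (u + t • z) = 0 := fun r t => by
      rw [hpol, QuadraticMap.polar_add_right, QuadraticMap.polar_smul_left,
        QuadraticMap.polar_smul_left, QuadraticMap.polar_smul_right, h1, h.polar_wz]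
      simp
    have p12 : QuadraticMap.polar q (u + (ε / c) • z) (u + (-ε / c) • z) = 0 := by
      rw [hpol, QuadraticMap.polar_add_left, QuadraticMap.polar_add_right,
        QuadraticMap.polar_add_right, QuadraticMap.polar_smul_left, QuadraticMap.polar_smul_left,
        QuadraticMap.polar_smul_right, QuadraticMap.polar_smul_right, QuadraticMap.polar_self,
        QuadraticMap.polar_self, h.Q_u, h.Q_z, h.polar_uz, h2]
      simp only [smul_eq_mul, smul_zero, mul_zero]
      ring
    intro i j hij
    fin_cases i <;> fin_cases j
    · exact absurd rfl hij
    · exact p01 _ _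
    · exact p01 _ _
    · exact (QuadraticMap.polar_comm _ _ _).trans (p01 _ _)
    · exact absurd rfl hij
    · exact p12
    · exact (QuadraticMap.polar_comm _ _ _).trans (p01 _ _)
    · exact (QuadraticMap.polar_comm _ _ _).trans p12
    · exact absurd rfl hij
  · change q ((2 / s) • w) = 1
    rw [hqε, QuadraticMap.map_smul, h.Q_w, smul_eq_mul]
    field_simp
    linarith
  · change q (u + (ε / c) • z) = 1
    rw [hqε, hQadd, div_mul_cancel₀ _ hc, hε]
  · change q (u + (-ε / c) • z) = -1
    rw [hqε, hQadd, div_mul_cancel₀ _ hc, mul_neg, hε]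

/-- For an orthonormal frame `e` of the span of `u, w, z`, the matrices of `e₁e₂`, `e₂e₀` and
`-e₀e₁` on the pair `φ, ψ` define a linear map `A` with `v φᵢ = ∑ⱼ A(v)ᵢⱼ ω φⱼ`. The trace of the
matrix of `xy` is `polar x y`, so `A(v)` is traceless. -/
theorem exists_linearMap (h : IsSpinorTriple φ ψ u w z c) {q : QuadraticForm ℝ R10} {ε : ℝ}
    (hε : ε * ε = 1) (hq : ∀ v, Q10 v = ε * q v) {V : Submodule ℝ R10}
    (hV : V = Submodule.span ℝ {u, w, z}) (hV3 : Module.finrank ℝ V = 3)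
    {e : Fin 3 → R10} (he : IsFrame q V e) :
    ∃ A : V →ₗ[ℝ] Matrix (Fin 2) (Fin 2) ℝ, (∀ v, (A v).trace = 0) ∧
      (∀ v, A v * A v = q (v : R10) • 1) ∧ ∀ v : V,
        vecAct (v : R10) φ = A v 0 0 • cliffAct (volElt e) φ + A v 0 1 • cliffAct (volElt e) ψ ∧
        vecAct (v : R10) ψ = A v 1 0 • cliffAct (volElt e) φ + A v 1 1 • cliffAct (volElt e) ψ := by
  have hP : ∀ i, ∃ x : Fin 3 → ℝ, e i = x 0 • u + x 1 • w + x 2 • z := fun i => by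
    have hi := he.1 i
    rw [hV, Submodule.mem_span_triple] at hi
    obtain ⟨a, b, d, hi⟩ := hi
    exact ⟨![a, b, d], by simp [← hi]⟩
  choose P hP using hP
  have hortho : ∀ i j, i ≠ j → QuadraticMap.polar Q10 (e i) (e j) = 0 := fun i j hij => by
    have := he.2.1 i j hij
    rw [QuadraticMap.polar] at this ⊢
    rw [hq, hq, hq]
    linear_combination ε * this
  have hn0 : Q10 (e 0) = ε := by rw [hq, he.2.2.1, mul_one]
  have hn1 : Q10 (e 1) = ε := by rw [hq, he.2.2.2.1, mul_one]
  have hn2 : Q10 (e 2) = -ε := by rw [hq, he.2.2.2.2, mul_neg, mul_one]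
  obtain ⟨b, hb⟩ := he.isOrthonormal21.exists_basis hV3
  have hb' : ∀ i, (b i : R10) = e i := fun i => congrArg Subtype.val (hb i)
  let A : V →ₗ[ℝ] Matrix (Fin 2) (Fin 2) ℝ := b.constr ℝ
    ![bivectorMatrix c (P 1) (P 2), bivectorMatrix c (P 2) (P 0), -bivectorMatrix c (P 0) (P 1)]
  have hA : ∀ i, A (b i) = ![bivectorMatrix c (P 1) (P 2), bivectorMatrix c (P 2) (P 0),
      -bivectorMatrix c (P 0) (P 1)] i := fun i => b.constr_basis ℝ _ i
  have hsum : ∀ v : V, v = b.repr v 0 • b 0 + b.repr v 1 • b 1 + b.repr v 2 • b 2 := fun v => by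
    conv_lhs => rw [← b.sum_repr v, Fin.sum_univ_three]
  have htr : ∀ v, (A v).trace = 0 := fun v => by
    have ht : ∀ i j, i ≠ j → (bivectorMatrix c (P i) (P j)).trace = 0 := fun i j hij => by
      rw [h.trace_bivectorMatrix, ← hP, ← hP, hortho i j hij]
    rw [hsum v]
    simp [hA, ht]
  have hrel : ∀ v : V,
      vecAct (v : R10) φ = A v 0 0 • cliffAct (volElt e) φ + A v 0 1 • cliffAct (volElt e) ψ ∧
      vecAct (v : R10) ψ = A v 1 0 • cliffAct (volElt e) φ + A v 1 1 • cliffAct (volElt e) ψ := by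
    have key : ∀ i,
        vecAct (e i) φ = A (b i) 0 0 • cliffAct (volElt e) φ + A (b i) 0 1 • cliffAct (volElt e) ψ ∧
        vecAct (e i) ψ =
          A (b i) 1 0 • cliffAct (volElt e) φ + A (b i) 1 1 • cliffAct (volElt e) ψ := by
      have h12 := h.act_act (P 1) (P 2)
      have h20 := h.act_act (P 2) (P 0)
      have h01 := h.act_act (P 0) (P 1)
      simp only [← hP] at h12 h20 h01
      have v12 := volElt_bivector_12 hortho
      have v20 := volElt_bivector_20 hortho
      have v01 := volElt_bivector_01 hortho
      rw [hn1, hn2, mul_neg, hε, neg_neg] at v12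
      rw [hn0, hn2, neg_mul, hε, neg_neg] at v20
      rw [hn0, hn1, hε] at v01
      intro i
      rw [hA]
      fin_cases i
      · have e1 := v12 φ
        have e2 := v12 ψ
        rw [h12.1, map_add, map_smul, map_smul, one_smul] at e1
        rw [h12.2, map_add, map_smul, map_smul, one_smul] at e2
        exact ⟨e1.symm, e2.symm⟩
      · have e1 := v20 φ
        have e2 := v20 ψ
        rw [h20.1, map_add, map_smul, map_smul, one_smul] at e1
        rw [h20.2, map_add, map_smul, map_smul, one_smul] at e2
        exact ⟨e1.symm, e2.symm⟩
      · have e1 := v01 φ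
        have e2 := v01 ψ
        rw [h01.1, map_add, map_smul, map_smul] at e1
        rw [h01.2, map_add, map_smul, map_smul] at e2
        constructor
        · change vecAct (e 2) φ = (-bivectorMatrix c (P 0) (P 1)) 0 0 • _ +
            (-bivectorMatrix c (P 0) (P 1)) 0 1 • _
          rw [Matrix.neg_apply, Matrix.neg_apply]
          linear_combination (norm := module) e1
        · change vecAct (e 2) ψ = (-bivectorMatrix c (P 0) (P 1)) 1 0 • _ +
            (-bivectorMatrix c (P 0) (P 1)) 1 1 • _
          rw [Matrix.neg_apply, Matrix.neg_apply]
          linear_combination (norm := module) e2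
    intro v
    have hv : (v : R10) = b.repr v 0 • e 0 + b.repr v 1 • e 1 + b.repr v 2 • e 2 := by
      simpa [hb'] using congrArg Subtype.val (hsum v)
    have hAv : A v = b.repr v 0 • A (b 0) + b.repr v 1 • A (b 1) + b.repr v 2 • A (b 2) := by
      conv_lhs => rw [hsum v]
      simp only [map_add, map_smul]
    constructor
    · rw [hv, hAv]
      simp only [map_add, map_smul, LinearMap.add_apply, LinearMap.smul_apply, (key _).1,
        Matrix.add_apply, Matrix.smul_apply, smul_eq_mul]
      module
    · rw [hv, hAv]
      simp only [map_add, map_smul, LinearMap.add_apply, LinearMap.smul_apply, (key _).2,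
        Matrix.add_apply, Matrix.smul_apply, smul_eq_mul]
      module
  refine ⟨A, htr, fun v => ?_, hrel⟩
  have hcomm : ∀ χ, vecAct (v : R10) (cliffAct (volElt e) χ) =
      cliffAct (volElt e) (vecAct (v : R10) χ) := fun χ => by
    have hv : (v : R10) = b.repr v 0 • e 0 + b.repr v 1 • e 1 + b.repr v 2 • e 2 := by
      simpa [hb'] using congrArg Subtype.val (hsum v)
    rw [hv]
    simp only [map_add, map_smul, LinearMap.add_apply, LinearMap.smul_apply, volElt_comm hortho]
  have hΩ : ∀ χ, cliffAct (volElt e) (cliffAct (volElt e) χ) = ε • χ := fun χ => by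
    rw [volElt_volElt hortho, hn0, hn1, hn2, hε, one_mul, neg_neg]
  -- both sides of `v v = a(v)² ω²` are evaluated on `φ` and `ψ`
  have e1 := vecAct_vecAct (v : R10) φ
  have e2 := vecAct_vecAct (v : R10) ψ
  rw [(hrel v).1, map_add, map_smul, map_smul, hcomm, hcomm, (hrel v).1, (hrel v).2, map_add,
    map_add, map_smul, map_smul, map_smul, map_smul, hΩ, hΩ, hq] at e1
  rw [(hrel v).2, map_add, map_smul, map_smul, hcomm, hcomm, (hrel v).1, (hrel v).2, map_add,
    map_add, map_smul, map_smul, map_smul, map_smul, hΩ, hΩ, hq] at e2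
  have hε0 : ε ≠ 0 := fun h0 => by rw [h0] at hε; norm_num at hε
  obtain ⟨a1, a2⟩ := h.indep
    (ε * (A v 0 0 * A v 0 0 + A v 0 1 * A v 1 0 - q v)) (ε * (A v 0 0 * A v 0 1 + A v 0 1 * A v 1 1))
    (by linear_combination (norm := module) e1)
  obtain ⟨a3, a4⟩ := h.indep
    (ε * (A v 1 0 * A v 0 0 + A v 1 1 * A v 1 0)) (ε * (A v 1 0 * A v 0 1 + A v 1 1 * A v 1 1 - q v))
    (by linear_combination (norm := module) e2)
  have b1 := (mul_eq_zero.mp a1).resolve_left hε0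
  have b2 := (mul_eq_zero.mp a2).resolve_left hε0
  have b3 := (mul_eq_zero.mp a3).resolve_left hε0
  have b4 := (mul_eq_zero.mp a4).resolve_left hε0
  ext i j
  fin_cases i <;> fin_cases j <;> simp [Matrix.mul_apply, Fin.sum_univ_two] <;> linarith

end IsSpinorTriple

/-! ### Components of an element of `S ⊗ ℝ²` -/

/-- The components of `ρ ∈ S ⊗ ℝ²` as a pair of half-spinors. -/
def components (p : ZMod 2) : Spinor2 p ≃ₗ[ℝ] (Fin 2 → HalfSpin p) :=
  TensorProduct.piScalarRight ℝ ℝ (HalfSpin p) (Fin 2)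

/-- The components of an element of `Λ T* ⊗ ℝ²`. -/
def formComponents : Forms ⊗[ℝ] (Fin 2 → ℝ) ≃ₗ[ℝ] (Fin 2 → Forms) :=
  TensorProduct.piScalarRight ℝ ℝ Forms (Fin 2)

theorem formComponents_cliffMul {p : ZMod 2} (x : CliffordAlgebra Q10)
    (A : Matrix (Fin 2) (Fin 2) ℝ) (ρ : Spinor2 p) (i : Fin 2) :
    formComponents (cliffMul x A ρ) i =
      A i 0 • cliffAct x (components p ρ 0) + A i 1 • cliffAct x (components p ρ 1) := by
  induction ρ using TensorProduct.induction_on with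
  | zero => simp [cliffMul]
  | tmul φ f =>
    fin_cases i <;> simp [cliffMul, formComponents, components] <;> module
  | add ρ ρ' h h' =>
    rw [cliffMul, map_add, map_add, Pi.add_apply]
    rw [cliffMul] at h h'
    rw [h, h', map_add]
    simp only [Pi.add_apply, Submodule.coe_add, map_add]
    module

/-- The equation `v · ρ = a ω · ρ` in components. -/
theorem cliffMul_ι_eq_iff {p : ZMod 2} (v : R10) (x : CliffordAlgebra Q10)
    (A : Matrix (Fin 2) (Fin 2) ℝ) (ρ : Spinor2 p) :
    cliffMul (CliffordAlgebra.ι Q10 v) 1 ρ = cliffMul x A ρ ↔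
      ∀ i, vecAct v (components p ρ i) =
        A i 0 • cliffAct x (components p ρ 0) + A i 1 • cliffAct x (components p ρ 1) := by
  rw [← formComponents.injective.eq_iff, funext_iff]
  have hv : ∀ χ, cliffAct (CliffordAlgebra.ι Q10 v) χ = vecAct v χ := fun χ => by
    simp [cliffAct]
  simp only [formComponents_cliffMul, hv, Fin.forall_fin_two]
  simp

/-- The quartic invariant `polar β(φ, φ) β(ψ, ψ)` of `ρ = (φ, ψ)`. -/
def quartic {p : ZMod 2} (ρ : Spinor2 p) : ℝ :=
  QuadraticMap.polar Q10 (spinorVec (components p ρ 0) (components p ρ 0))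
    (spinorVec (components p ρ 1) (components p ρ 1))

/-- The span of the three vectors `β(φ, φ), β(φ, ψ), β(ψ, ψ)` of `ρ = (φ, ψ)`. -/
def spinorSpan {p : ZMod 2} (ρ : Spinor2 p) : Submodule ℝ R10 :=
  Submodule.span ℝ {spinorVec (components p ρ 0) (components p ρ 0 : Forms),
    spinorVec (components p ρ 0) (components p ρ 1 : Forms),
    spinorVec (components p ρ 1) (components p ρ 1 : Forms)}

theorem isSpinorTriple_components {p : ZMod 2} {ρ : Spinor2 p} (hρ : quartic ρ ≠ 0) :
    IsSpinorTriple (components p ρ 0) (components p ρ 1 : Forms)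
      (spinorVec (components p ρ 0) (components p ρ 0 : Forms))
      (spinorVec (components p ρ 0) (components p ρ 1 : Forms))
      (spinorVec (components p ρ 1) (components p ρ 1 : Forms)) (quartic ρ) :=
  isSpinorTriple (components p ρ 0).2 (components p ρ 1).2 hρ

theorem finrank_spinorSpan {p : ZMod 2} {ρ : Spinor2 p} (hρ : quartic ρ ≠ 0) :
    Module.finrank ℝ (spinorSpan ρ) = 3 := by
  obtain ⟨ε, q, -, -, -, e, he⟩ := (isSpinorTriple_components hρ).exists_isFrame
  exact IsOrthonormal21.finrank_span (M := R10) (q := q) (e := e) he.2 he.1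

theorem isSpinorSubspace_spinorSpan {p : ZMod 2} {ρ : Spinor2 p} (hρ : quartic ρ ≠ 0) :
    IsSpinorSubspace ρ (spinorSpan ρ) := by
  have h := isSpinorTriple_components hρ
  have h3 := finrank_spinorSpan hρ
  obtain ⟨ε, q, hε, hq, hqε, f, hf⟩ := h.exists_isFrame
  refine ⟨h3, q, hq, IsOrthonormal21.hasSignature
    (IsFrame.isOrthonormal21 (V := spinorSpan ρ) hf) h3, fun e he => ?_⟩
  obtain ⟨A, htr, hsq, hA⟩ := h.exists_linearMap (V := spinorSpan ρ) hε hqε rfl h3 he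
  obtain ⟨a, ha⟩ := exists_sl_equiv he.isOrthonormal21 h3 A htr hsq
  refine ⟨a, fun v => ⟨?_, ?_⟩⟩
  · rw [cliffMul_ι_eq_iff, Fin.forall_fin_two, ha]
    exact hA v
  · rw [ha, sq, hsq, Matrix.trace_smul, Matrix.trace_one, Fintype.card_fin, smul_eq_mul]
    push_cast
    ring

/-! ### Uniqueness -/

/-- For every combination `χ` of the components of `ρ`, a subspace as in the theorem contains a
nonzero vector annihilating `χ`, namely one with `a(v)` nilpotent, and hence `β(χ, χ)`. -/
theorem IsSpinorSubspace.spinorVec_mem {p : ZMod 2} {ρ : Spinor2 p} {W : Submodule ℝ R10}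
    (hW : IsSpinorSubspace ρ W) {s t : ℝ} (hst : s ≠ 0 ∨ t ≠ 0) :
    spinorVec (s • (components p ρ 0 : Forms) + t • (components p ρ 1 : Forms))
      (s • (components p ρ 0 : Forms) + t • (components p ρ 1 : Forms)) ∈ W := by
  obtain ⟨-, q, -, hsig, h⟩ := hW
  obtain ⟨f, hf⟩ := exists_isOrthonormal21 hsig
  obtain ⟨a, ha⟩ := h (fun i => f i) ⟨fun i => (f i).2, hf⟩
  -- the nilpotent matrix with image spanned by `(t, -s)`, so that `(s, t) N = 0`
  let N : LieAlgebra.SpecialLinear.sl (Fin 2) ℝ :=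
    ⟨!![t * s, t * t; -(s * s), -(s * t)], by
      change Matrix.trace (!![t * s, t * t; -(s * s), -(s * t)] : Matrix (Fin 2) (Fin 2) ℝ) = 0
      rw [Matrix.trace_fin_two_of]; ring⟩
  have hN : N ≠ 0 := fun h0 => by
    have h1 : t * t = 0 := congrFun (congrFun (congrArg Subtype.val h0) 0) 1
    have h2 : -(s * s) = 0 := congrFun (congrFun (congrArg Subtype.val h0) 1) 0
    rcases hst with h | h
    · exact h (mul_self_eq_zero.mp (neg_eq_zero.mp h2))
    · exact h (mul_self_eq_zero.mp h1)
  have hv0 : ((a.symm N : W) : R10) ≠ 0 := fun h0 =>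
    hN ((a.symm.map_eq_zero_iff).mp (Subtype.ext h0))
  have hv := (ha (a.symm N)).1
  rw [a.apply_symm_apply, cliffMul_ι_eq_iff] at hv
  have h1 := hv 0
  have h2 := hv 1
  obtain ⟨x, hx⟩ := exists_polar_eq_one hv0
  rw [spinorVec_self_of_vecAct_eq_zero hx]
  · exact W.smul_mem _ (a.symm N).2
  · rw [map_add, map_smul, map_smul, h1, h2]
    simp only [N, Matrix.of_apply, Matrix.cons_val', Matrix.cons_val_zero, Matrix.cons_val_one,
      Matrix.cons_val_fin_one]
    module

theorem eq_of_le_of_finrank_eq_three {M : Type*} [AddCommGroup M] [Module ℝ M]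
    {V W : Submodule ℝ M} (h : V ≤ W) (hV : Module.finrank ℝ V = 3)
    (hW : Module.finrank ℝ W = 3) : V = W := by
  have : FiniteDimensional ℝ W := Module.finite_of_finrank_pos (by omega)
  exact Submodule.eq_of_le_of_finrank_eq h (hV.trans hW.symm)

theorem IsSpinorSubspace.eq_spinorSpan {p : ZMod 2} {ρ : Spinor2 p} (hρ : quartic ρ ≠ 0)
    {W : Submodule ℝ R10} (hW : IsSpinorSubspace ρ W) : W = spinorSpan ρ := by
  refine (eq_of_le_of_finrank_eq_three (M := R10) ?_ (finrank_spinorSpan hρ) hW.1).symm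
  have h1 := hW.spinorVec_mem (s := 1) (t := 0) (Or.inl one_ne_zero)
  have h2 := hW.spinorVec_mem (s := 0) (t := 1) (Or.inr one_ne_zero)
  have h3 := hW.spinorVec_mem (s := 1) (t := 1) (Or.inl one_ne_zero)
  simp only [one_smul, zero_smul, add_zero, zero_add] at h1 h2 h3
  refine Submodule.span_le.mpr ?_
  rintro x (rfl | rfl | rfl)
  · exact h1
  · have h4 := W.smul_mem (1 / 2 : ℝ) (W.sub_mem (W.sub_mem h3 h1) h2)
    rw [map_add, map_add, LinearMap.add_apply, LinearMap.add_apply,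
      spinorVec_comm (components p ρ 1 : Forms) (components p ρ 0 : Forms)] at h4
    refine (congrArg (· ∈ W) ?_).mp h4
    module
  · exact h2

/-! ### The quartic invariant does not vanish on open sets -/

/-- The covector `e_i`, as a one-form. -/
abbrev basisForm (i : Fin 5) : Forms := ExteriorAlgebra.ι ℝ (Pi.single i 1)

theorem contr_coord_mul (i j : Fin 5) (φ : Forms) : contr (coord i) (basisForm j * φ) =
    (if i = j then (1 : ℝ) else 0) • φ - basisForm j * contr (coord i) φ := by
  rw [contr_ι_mul]
  simp [Pi.single_apply]

theorem algebraMapInv_ι (m : E5) :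
    ExteriorAlgebra.algebraMapInv (ExteriorAlgebra.ι ℝ m) = (0 : ℝ) := by
  simp [ExteriorAlgebra.algebraMapInv]

theorem pairing_one (φ : Forms) : pairing 1 φ = topCoeff φ := by
  rw [pairing_apply, CliffordAlgebra.reverse.map_one, one_mul]

theorem pairing_ι (m : E5) (φ : Forms) :
    pairing (ExteriorAlgebra.ι ℝ m) φ = topCoeff (ExteriorAlgebra.ι ℝ m * φ) := by
  have := pairing_ι_mul m 1 φ
  rwa [mul_one, pairing_one] at this

/-- The forms `φ = 1 + e₀₁₂₃` and `ψ = e₀₄ + e₁₂₃₄` have nonzero quartic invariant; `φ` is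
annihilated by the contraction with the last coordinate, which is therefore proportional to
`β(φ, φ)`. -/
theorem quartic_example :
    QuadraticMap.polar Q10
      (spinorVec (1 + basisForm 0 * (basisForm 1 * (basisForm 2 * (basisForm 3 * 1))))
        (1 + basisForm 0 * (basisForm 1 * (basisForm 2 * (basisForm 3 * 1)))))
      (spinorVec (basisForm 0 * (basisForm 4 * 1) +
          basisForm 1 * (basisForm 2 * (basisForm 3 * (basisForm 4 * 1))))
        (basisForm 0 * (basisForm 4 * 1) +
          basisForm 1 * (basisForm 2 * (basisForm 3 * (basisForm 4 * 1))))) ≠ 0 := by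
  have hx : QuadraticMap.polar Q10 ((coord 4, 0) : R10) (0, Pi.single 4 1) = 1 := by
    rw [polar_Q10]; simp
  rw [spinorVec_self_of_vecAct_eq_zero hx, QuadraticMap.polar_smul_left, polar_spinorVec,
    vecAct_snd, vecAct_fst]
  · simp [contr_coord_mul, pairing_ι_mul, pairing_one, pairing_ι, topCoeff, mul_add,
      algebraMapInv_ι]
  · rw [vecAct_fst]
    simp [contr_coord_mul]

/-- The quartic invariant is not identically zero: for odd forms, the even example is
reflected. -/
theorem exists_quartic_ne_zero (p : ZMod 2) : ∃ ρ : Spinor2 p, quartic ρ ≠ 0 := by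
  suffices h : ∃ φ ψ : HalfSpin p, QuadraticMap.polar Q10 (spinorVec (φ : Forms) (φ : Forms))
      (spinorVec (ψ : Forms) (ψ : Forms)) ≠ 0 by
    obtain ⟨φ, ψ, h⟩ := h
    refine ⟨(components p).symm ![φ, ψ], ?_⟩
    rw [quartic, LinearEquiv.apply_symm_apply]
    exact h
  have two : ∀ i j, basisForm i * basisForm j ∈ HalfSpin 0 := fun i j =>
    CliffordAlgebra.ι_mul_ι_mem_evenOdd_zero _ _ _
  have four : ∀ i j k l, basisForm i * (basisForm j * (basisForm k * (basisForm l * 1))) ∈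
      HalfSpin 0 := fun i j k l => by
    rw [mul_one, ← mul_assoc]
    have := SetLike.mul_mem_graded (two i j) (two k l)
    rwa [add_zero] at this
  have h1 : 1 + basisForm 0 * (basisForm 1 * (basisForm 2 * (basisForm 3 * 1))) ∈ HalfSpin 0 :=
    Submodule.add_mem _ (SetLike.one_mem_graded
      (CliffordAlgebra.evenOdd (0 : QuadraticForm ℝ E5))) (four 0 1 2 3)
  have h2 : basisForm 0 * (basisForm 4 * 1) +
      basisForm 1 * (basisForm 2 * (basisForm 3 * (basisForm 4 * 1))) ∈ HalfSpin 0 :=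
    Submodule.add_mem _ (by rw [mul_one]; exact two 0 4) (four 1 2 3 4)
  obtain rfl | rfl := (by decide : ∀ q : ZMod 2, q = 0 ∨ q = 1) p
  · exact ⟨⟨_, h1⟩, ⟨_, h2⟩, quartic_example⟩
  · have h3 := vecAct_mem unitVec h1
    have h4 := vecAct_mem unitVec h2
    rw [zero_add] at h3 h4
    refine ⟨⟨_, h3⟩, ⟨_, h4⟩, ?_⟩
    have h5 := quartic_example
    -- a reflection preserves the polar form
    rw [spinorVec_vecAct, spinorVec_vecAct, Q10_unitVec, one_smul, one_smul]
    generalize spinorVec _ _ = u at h5 ⊢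
    generalize spinorVec _ _ = z at h5 ⊢
    convert h5 using 1
    rw [QuadraticMap.polar_sub_left, QuadraticMap.polar_sub_right, QuadraticMap.polar_sub_right,
      QuadraticMap.polar_smul_left, QuadraticMap.polar_smul_left, QuadraticMap.polar_smul_right,
      QuadraticMap.polar_smul_right, QuadraticMap.polar_self, Q10_unitVec,
      QuadraticMap.polar_comm Q10 u unitVec]
    simp only [smul_eq_mul, nsmul_eq_mul]
    push_cast
    ring

/-- Along a line the quartic invariant is a polynomial. -/
theorem exists_polynomial_quartic {p : ZMod 2} (ρ δ : Spinor2 p) :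
    ∃ P : Polynomial ℝ, ∀ t : ℝ, quartic (ρ + t • δ) = P.eval t := by
  have h1 : ∀ i, ∃ a b d : R10, ∀ t : ℝ,
      spinorVec (components p (ρ + t • δ) i : Forms) (components p (ρ + t • δ) i : Forms) =
        a + t • b + (t * t) • d := fun i => by
    refine ⟨spinorVec (components p ρ i : Forms) (components p ρ i : Forms),
      (2 : ℝ) • spinorVec (components p ρ i : Forms) (components p δ i : Forms),
      spinorVec (components p δ i : Forms) (components p δ i : Forms), fun t => ?_⟩
    rw [map_add, map_smul, Pi.add_apply, Pi.smul_apply, Submodule.coe_add, Submodule.coe_smul,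
      map_add, map_add, map_smul, map_smul, LinearMap.add_apply, LinearMap.add_apply,
      LinearMap.smul_apply, LinearMap.smul_apply,
      spinorVec_comm (components p δ i : Forms) (components p ρ i : Forms)]
    module
  obtain ⟨a, b, d, h0⟩ := h1 0
  obtain ⟨a', b', d', h0'⟩ := h1 1
  let B := QuadraticMap.polar Q10
  refine ⟨Polynomial.C (B a a') + Polynomial.C (B a b' + B b a') * Polynomial.X +
    Polynomial.C (B a d' + B b b' + B d a') * Polynomial.X ^ 2 +
    Polynomial.C (B b d' + B d b') * Polynomial.X ^ 3 + Polynomial.C (B d d') * Polynomial.X ^ 4,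
    fun t => ?_⟩
  rw [quartic, h0, h0']
  simp only [QuadraticMap.polar_add_left, QuadraticMap.polar_add_right,
    QuadraticMap.polar_smul_left, QuadraticMap.polar_smul_right, smul_eq_mul, B,
    Polynomial.eval_add, Polynomial.eval_mul, Polynomial.eval_C, Polynomial.eval_X,
    Polynomial.eval_pow]
  ring

/-- A nonempty open set contains points where the quartic invariant does not vanish. -/
theorem exists_quartic_ne_zero_of_isOpen {p : ZMod 2} {U : Set (Spinor2 p)}
    (hU : IsOpen[moduleTopology ℝ (Spinor2 p)] U) {ρ : Spinor2 p} (hρ : ρ ∈ U) :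
    ∃ ρ' ∈ U, quartic ρ' ≠ 0 := by
  let _ : TopologicalSpace (Spinor2 p) := moduleTopology ℝ (Spinor2 p)
  have : IsModuleTopology ℝ (Spinor2 p) := ⟨rfl⟩
  have : ContinuousAdd (Spinor2 p) := IsModuleTopology.toContinuousAdd ℝ _
  have : ContinuousSMul ℝ (Spinor2 p) := IsModuleTopology.toContinuousSMul ℝ _
  by_contra! H
  obtain ⟨ρ₀, h0⟩ := exists_quartic_ne_zero p
  obtain ⟨P, hP⟩ := exists_polynomial_quartic ρ (ρ₀ - ρ)
  have hcont : Continuous fun t : ℝ => ρ + t • (ρ₀ - ρ) :=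
    continuous_const.add (continuous_id.smul continuous_const)
  have hmem : (fun t : ℝ => ρ + t • (ρ₀ - ρ)) ⁻¹' U ∈ 𝓝 (0 : ℝ) :=
    (hU.preimage hcont).mem_nhds (by simpa using hρ)
  have hP0 : P = 0 := Polynomial.eq_zero_of_infinite_isRoot P
    ((infinite_of_mem_nhds 0 hmem).mono fun t ht => by
      rw [Set.mem_ofPred_eq, Polynomial.IsRoot, ← hP]
      exact H _ ht)
  refine h0 ?_
  have := hP 1
  rwa [hP0, Polynomial.eval_zero, one_smul, add_sub_cancel] at this

/-! ### Equivariance -/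

theorem cliffAct_ι (v : R10) : cliffAct (CliffordAlgebra.ι Q10 v) = vecAct v := by
  simp [cliffAct]

/-- Vectors embed into the Clifford algebra: the polar form is recovered from their action on
forms. -/
theorem ι_injective : Function.Injective (CliffordAlgebra.ι Q10) := by
  intro v w h
  have hvec : vecAct v = vecAct w := by rw [← cliffAct_ι, ← cliffAct_ι, h]
  have hp : ∀ (x a : R10), algebraMap ℝ Forms (QuadraticMap.polar Q10 x a) =
      vecAct x (vecAct a 1) + vecAct a (vecAct x 1) := fun x a => by
    rw [vecAct_anticomm, Algebra.algebraMap_eq_smul_one]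
  refine eq_of_polar_eq fun x => ExteriorAlgebra.algebraMap_leftInverse E5 |>.injective ?_
  rw [hp, hp, hvec]

theorem spinGroup_mul_inv (g : spinGroup Q10) : (g : CliffordAlgebra Q10) *
    ((g⁻¹ : spinGroup Q10) : CliffordAlgebra Q10) = 1 := by
  rw [← Submonoid.coe_mul, mul_inv_cancel, Submonoid.coe_one]

theorem spinGroup_inv_mul (g : spinGroup Q10) : ((g⁻¹ : spinGroup Q10) : CliffordAlgebra Q10) *
    (g : CliffordAlgebra Q10) = 1 := by
  rw [← Submonoid.coe_mul, inv_mul_cancel, Submonoid.coe_one]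

/-- Conjugation by an element of `Spin(5,5)`, as a linear automorphism of `ℝ¹⁰`. -/
theorem exists_rotation (g : spinGroup Q10) : ∃ L : R10 ≃ₗ[ℝ] R10, ∀ v,
    CliffordAlgebra.ι Q10 (L v) = (g : CliffordAlgebra Q10) * CliffordAlgebra.ι Q10 v *
      ((g⁻¹ : spinGroup Q10) : CliffordAlgebra Q10) := by
  have h : ∀ (g : spinGroup Q10) (v : R10), ∃ w, CliffordAlgebra.ι Q10 w =
      (g : CliffordAlgebra Q10) * CliffordAlgebra.ι Q10 v *
        ((g⁻¹ : spinGroup Q10) : CliffordAlgebra Q10) := fun g v => by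
    obtain ⟨w, hw⟩ := spinGroup.conjAct_smul_ι_mem_range_ι (x := spinGroup.toUnits g) g.2 v
    refine ⟨w, hw.trans ?_⟩
    rw [ConjAct.units_smul_def, ConjAct.ofConjAct_toConjAct]
    rfl
  choose L hL using h
  have hinv : ∀ g v, L g (L g⁻¹ v) = v := fun g v => ι_injective (by
    rw [hL, hL, inv_inv]
    simp only [mul_assoc]
    rw [spinGroup_mul_inv, mul_one, ← mul_assoc, spinGroup_mul_inv, one_mul])
  refine ⟨LinearEquiv.ofLinearMap
    { toFun := L g
      map_add' := fun v w => ι_injective (by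
        rw [hL, map_add, map_add, hL, hL, mul_add, add_mul])
      map_smul' := fun r v => ι_injective (by
        rw [hL, RingHom.id_apply, map_smul, map_smul, hL, mul_smul_comm, smul_mul_assoc]) }
    { toFun := L g⁻¹
      map_add' := fun v w => ι_injective (by
        rw [hL, map_add, map_add, hL, hL, mul_add, add_mul])
      map_smul' := fun r v => ι_injective (by
        rw [hL, RingHom.id_apply, map_smul, map_smul, hL, mul_smul_comm, smul_mul_assoc]) }
    (LinearMap.ext fun v => hinv g v) (LinearMap.ext fun v => ?_), hL g⟩
  have := hinv g⁻¹ v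
  rwa [inv_inv] at this

section Transfer

variable {g : spinGroup Q10} {L : R10 ≃ₗ[ℝ] R10}

theorem Q10_rotation (hL : ∀ v, CliffordAlgebra.ι Q10 (L v) =
    (g : CliffordAlgebra Q10) * CliffordAlgebra.ι Q10 v *
      ((g⁻¹ : spinGroup Q10) : CliffordAlgebra Q10)) (v : R10) : Q10 (L v) = Q10 v := by
  have h : algebraMap ℝ (CliffordAlgebra Q10) (Q10 (L v)) = algebraMap ℝ _ (Q10 v) := by
    rw [← CliffordAlgebra.ι_sq_scalar, hL]
    have : ∀ a b c d : CliffordAlgebra Q10, d * a = 1 → a * b * d * (a * b * d) = a * (b * b) * d :=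
      fun a b c d h => by
        rw [mul_assoc (a * b), ← mul_assoc d, ← mul_assoc d, h, one_mul]
        simp only [mul_assoc]
    rw [this _ _ 1 _ (spinGroup_inv_mul g), CliffordAlgebra.ι_sq_scalar, ← Algebra.commutes,
      mul_assoc, spinGroup_mul_inv, mul_one]
  have h2 := congrArg (fun x => ExteriorAlgebra.algebraMapInv (cliffAct x 1)) h
  simpa only [AlgHom.commutes, Module.algebraMap_end_apply, map_smul, map_one, smul_eq_mul,
    mul_one] using h2

theorem volElt_rotation (hL : ∀ v, CliffordAlgebra.ι Q10 (L v) =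
    (g : CliffordAlgebra Q10) * CliffordAlgebra.ι Q10 v *
      ((g⁻¹ : spinGroup Q10) : CliffordAlgebra Q10)) (e : Fin 3 → R10) :
    volElt (fun i => L (e i)) = (g : CliffordAlgebra Q10) * volElt e *
      ((g⁻¹ : spinGroup Q10) : CliffordAlgebra Q10) := by
  have : ∀ a b c d x : CliffordAlgebra Q10, d * a = 1 →
      a * b * d * (a * c * d) * (a * x * d) = a * (b * c * x) * d := fun a b c d x h => by
    have e1 : a * b * d * (a * c * d) * (a * x * d) = a * b * (d * a) * c * (d * a) * x * d := by
      simp only [mul_assoc]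
    rw [e1, h]
    simp only [mul_assoc, mul_one]
  rw [volElt, hL, hL, hL, this _ _ _ _ _ (spinGroup_inv_mul g), volElt]

/-- The action of `(g, A)` transforms `x · a ρ` into `(g x g⁻¹) · (A a A⁻¹) ((g, A) ρ)`. -/
theorem cliffMul_spinGLRep {p : ZMod 2} (g : spinGroup Q10) (A : GL (Fin 2) ℝ)
    (x : CliffordAlgebra Q10) (m : Matrix (Fin 2) (Fin 2) ℝ) (ρ : Spinor2 p) :
    cliffMul ((g : CliffordAlgebra Q10) * x * ((g⁻¹ : spinGroup Q10) : CliffordAlgebra Q10))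
        ((A : Matrix (Fin 2) (Fin 2) ℝ) * m * ((A⁻¹ : GL (Fin 2) ℝ) : Matrix (Fin 2) (Fin 2) ℝ))
        (spinGLRep p (g, A) ρ) =
      TensorProduct.map (cliffAct (g : CliffordAlgebra Q10))
        (Matrix.toLin' (A : Matrix (Fin 2) (Fin 2) ℝ)) (cliffMul x m ρ) := by
  have hg : ∀ χ, cliffAct ((g⁻¹ : spinGroup Q10) : CliffordAlgebra Q10)
      (cliffAct (g : CliffordAlgebra Q10) χ) = χ := fun χ => by
    rw [← Module.End.mul_apply, ← map_mul, spinGroup_inv_mul, map_one, Module.End.one_apply]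
  have hA : ∀ f : Fin 2 → ℝ, ((A : Matrix (Fin 2) (Fin 2) ℝ) * m *
      ((A⁻¹ : GL (Fin 2) ℝ) : Matrix (Fin 2) (Fin 2) ℝ)).mulVec
      ((A : Matrix (Fin 2) (Fin 2) ℝ).mulVec f) =
      (A : Matrix (Fin 2) (Fin 2) ℝ).mulVec (m.mulVec f) := fun f => by
    rw [Matrix.mulVec_mulVec, Matrix.mulVec_mulVec, mul_assoc, ← Units.val_mul, inv_mul_cancel,
      Units.val_one, mul_one]
  induction ρ using TensorProduct.induction_on with
  | zero => simp only [cliffMul, map_zero]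
  | tmul φ f =>
    simp only [cliffMul, spinGLRep, MonoidHom.coe_mk, OneHom.coe_mk, TensorProduct.map_tmul,
      LinearMap.comp_apply, Submodule.subtype_apply, halfSpinRep, LinearMap.coe_restrict_apply,
      Matrix.toLin'_apply, hA, map_mul, Module.End.mul_apply, hg]
  | add ρ ρ' h h' =>
    simp only [cliffMul] at h h' ⊢
    simp only [map_add, h, h']

/-- Conjugation by `A` on `sl(2, ℝ)`. -/
def slConj (A : GL (Fin 2) ℝ) : LieAlgebra.SpecialLinear.sl (Fin 2) ℝ ≃ₗ[ℝ]
    LieAlgebra.SpecialLinear.sl (Fin 2) ℝ :=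
  LinearEquiv.ofLinearMap
    { toFun := fun x => ⟨(A : Matrix (Fin 2) (Fin 2) ℝ) * x.1 * (A⁻¹ : GL (Fin 2) ℝ), by
        have h : x.1.trace = 0 := x.2
        exact (Matrix.trace_units_conj A x.1).trans h⟩
      map_add' := fun x y => Subtype.ext (by simp [mul_add, add_mul])
      map_smul' := fun r x => Subtype.ext (by simp) }
    { toFun := fun x => ⟨((A⁻¹ : GL (Fin 2) ℝ) : Matrix (Fin 2) (Fin 2) ℝ) * x.1 * A, by
        have h : x.1.trace = 0 := x.2
        exact (Matrix.trace_units_conj' A x.1).trans h⟩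
      map_add' := fun x y => Subtype.ext (by simp [mul_add, add_mul])
      map_smul' := fun r x => Subtype.ext (by simp) }
    (LinearMap.ext fun x => Subtype.ext (by
      change (A : Matrix (Fin 2) (Fin 2) ℝ) * (((A⁻¹ : GL (Fin 2) ℝ) :
        Matrix (Fin 2) (Fin 2) ℝ) * x.1 * A) * (A⁻¹ : GL (Fin 2) ℝ) = x.1
      simp only [mul_assoc, Units.mul_inv, mul_one, Units.mul_inv_cancel_left]))
    (LinearMap.ext fun x => Subtype.ext (by
      change ((A⁻¹ : GL (Fin 2) ℝ) : Matrix (Fin 2) (Fin 2) ℝ) *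
        ((A : Matrix (Fin 2) (Fin 2) ℝ) * x.1 * (A⁻¹ : GL (Fin 2) ℝ)) * A = x.1
      simp only [mul_assoc, Units.inv_mul, mul_one, Units.inv_mul_cancel_left]))

theorem coe_slConj (A : GL (Fin 2) ℝ) (x : LieAlgebra.SpecialLinear.sl (Fin 2) ℝ) :
    (slConj A x : Matrix (Fin 2) (Fin 2) ℝ) =
      (A : Matrix (Fin 2) (Fin 2) ℝ) * x.1 * (A⁻¹ : GL (Fin 2) ℝ) := rfl

theorem exists_isFrame_of_hasSignature {q : QuadraticForm ℝ R10} {V : Submodule ℝ R10}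
    (h : HasSignature (M := V) (q.restrict V) 2 1) : ∃ e, IsFrame q V e := by
  obtain ⟨f, hf⟩ := exists_isOrthonormal21 h
  exact ⟨fun i => f i, fun i => (f i).2, hf⟩

/-- The defining property of `V_ρ` is transported by the group: `a` becomes
`v ↦ A a(g⁻¹ v g) A⁻¹`. -/
theorem IsSpinorSubspace.map {p : ZMod 2} {ρ : Spinor2 p} {W : Submodule ℝ R10}
    (hW : IsSpinorSubspace ρ W) (hL : ∀ v, CliffordAlgebra.ι Q10 (L v) =
      (g : CliffordAlgebra Q10) * CliffordAlgebra.ι Q10 v *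
        ((g⁻¹ : spinGroup Q10) : CliffordAlgebra Q10)) (A : GL (Fin 2) ℝ) :
    IsSpinorSubspace (spinGLRep p (g, A) ρ) (W.map (L : R10 →ₗ[ℝ] R10)) := by
  obtain ⟨h3, q, hq, hsig, h⟩ := hW
  have h3' : Module.finrank ℝ (W.map (L : R10 →ₗ[ℝ] R10)) = 3 :=
    (LinearEquiv.finrank_map_eq L W).trans h3
  have hqL : ∀ v, q (L v) = q v := by
    rcases hq with rfl | rfl
    · exact Q10_rotation hL
    · exact fun v => congrArg Neg.neg (Q10_rotation hL v)
  have hpol : ∀ v w, QuadraticMap.polar q (L v) (L w) = QuadraticMap.polar q v w := fun v w => by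
    rw [QuadraticMap.polar, QuadraticMap.polar, ← map_add, hqL, hqL, hqL]
  have hframe : ∀ e, IsFrame q W e → IsFrame q (W.map (L : R10 →ₗ[ℝ] R10)) fun i => L (e i) :=
    fun e he => ⟨fun i => Submodule.mem_map_of_mem (he.1 i),
      fun i j hij => (hpol _ _).trans (he.2.1 i j hij), (hqL _).trans he.2.2.1,
      (hqL _).trans he.2.2.2.1, (hqL _).trans he.2.2.2.2⟩
  obtain ⟨f, hf⟩ := exists_isFrame_of_hasSignature hsig
  refine ⟨h3', q, hq, IsOrthonormal21.hasSignature (hframe f hf).isOrthonormal21 h3',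
    fun e he => ?_⟩
  obtain ⟨e', rfl⟩ : ∃ e' : Fin 3 → R10, e = fun i => L (e' i) :=
    ⟨fun i => L.symm (e i), funext fun i => (L.apply_symm_apply _).symm⟩
  have he' : IsFrame q W e' := by
    refine ⟨fun i => ?_, fun i j hij => (hpol _ _).symm.trans (he.2.1 i j hij),
      (hqL _).symm.trans he.2.2.1, (hqL _).symm.trans he.2.2.2.1, (hqL _).symm.trans he.2.2.2.2⟩
    obtain ⟨v, hv, hve⟩ := he.1 i
    rwa [← L.injective hve]
  obtain ⟨a, ha⟩ := h e' he'
  refine ⟨(L.submoduleMap W).symm.trans (a.trans (slConj A)), fun v => ?_⟩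
  obtain ⟨v, rfl⟩ := (L.submoduleMap W).surjective v
  rw [LinearEquiv.trans_apply, LinearEquiv.symm_apply_apply, LinearEquiv.trans_apply, coe_slConj,
    LinearEquiv.submoduleMap_apply]
  obtain ⟨ha1, ha2⟩ := ha v
  constructor
  · rw [hL, volElt_rotation hL, cliffMul_spinGLRep, ← ha1, ← cliffMul_spinGLRep, mul_one,
      ← Units.val_mul, mul_inv_cancel, Units.val_one]
  · rw [hqL, ← ha2]
    have : ((A : Matrix (Fin 2) (Fin 2) ℝ) * (a v).1 * (A⁻¹ : GL (Fin 2) ℝ)) ^ 2 =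
        (A : Matrix (Fin 2) (Fin 2) ℝ) * (a v).1 ^ 2 * (A⁻¹ : GL (Fin 2) ℝ) := by
      simp only [sq, mul_assoc, Units.inv_mul_cancel_left]
    rw [this, Matrix.trace_units_conj]

end Transfer

/-! ### Open orbits -/

/-- Some point of an open orbit has nonzero quartic invariant, and the subspace found there is
carried back by the group. -/
theorem InOpenOrbit.exists_unique {p : ZMod 2} {ρ : Spinor2 p} (hρ : InOpenOrbit ρ) :
    ∃ V, IsSpinorSubspace ρ V ∧ ∀ W, IsSpinorSubspace ρ W → W = V := by
  obtain ⟨-, ⟨⟨g, A⟩, rfl⟩, hc⟩ := exists_quartic_ne_zero_of_isOpen hρ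
    (show ρ ∈ spinGLOrbit ρ from ⟨1, by simp⟩)
  obtain ⟨L, hL⟩ := exists_rotation g
  obtain ⟨L', hL'⟩ := exists_rotation g⁻¹
  have hback := (isSpinorSubspace_spinorSpan hc).map hL' A⁻¹
  have h1 : spinGLRep p (g⁻¹, A⁻¹) (spinGLRep p (g, A) ρ) = ρ := by
    rw [← Module.End.mul_apply, ← map_mul, Prod.mk_mul_mk, inv_mul_cancel, inv_mul_cancel,
      Prod.mk_one_one, map_one, Module.End.one_apply]
  change IsSpinorSubspace (spinGLRep p (g⁻¹, A⁻¹) (spinGLRep p (g, A) ρ)) _ at hback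
  rw [h1] at hback
  have huniq : ∀ W, IsSpinorSubspace ρ W →
      W.map (L : R10 →ₗ[ℝ] R10) = spinorSpan (spinGLRep p (g, A) ρ) := fun W hW =>
    (hW.map hL A).eq_spinorSpan hc
  exact ⟨_, hback, fun W hW =>
    Submodule.map_injective_of_injective L.injective ((huniq W hW).trans (huniq _ hback).symm)⟩

protected theorem InOpenOrbit.spinGLRep {p : ZMod 2} {ρ : Spinor2 p} (hρ : InOpenOrbit ρ)
    (g : spinGroup Q10 × GL (Fin 2) ℝ) : InOpenOrbit (spinGLRep p g ρ) := by
  have h : spinGLOrbit (SpinFiveFive.spinGLRep p g ρ) = spinGLOrbit ρ := by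
    ext x
    constructor
    · rintro ⟨k, rfl⟩
      exact ⟨k * g, by simp only [map_mul, Module.End.mul_apply]⟩
    · rintro ⟨k, rfl⟩
      refine ⟨k * g⁻¹, ?_⟩
      change SpinFiveFive.spinGLRep p (k * g⁻¹) (SpinFiveFive.spinGLRep p g ρ) = _
      rw [← Module.End.mul_apply, ← map_mul, inv_mul_cancel_right]
  rw [InOpenOrbit, h]
  exact hρ

end SpinFiveFive
end

open SpinFiveFive in
theorem mainTheorem6 (p : ZMod 2) :
    ∃ V : Spinor2 p → Submodule ℝ R10,
      (∀ ρ : Spinor2 p, InOpenOrbit ρ →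
        IsSpinorSubspace ρ (V ρ) ∧
          ∀ W : Submodule ℝ R10, IsSpinorSubspace ρ W → W = V ρ) ∧
      (∀ ρ : Spinor2 p, InOpenOrbit ρ →
        ∀ (g : spinGroup Q10) (A : GL (Fin 2) ℝ) (v w : R10),
          CliffordAlgebra.ι Q10 w =
              (g : CliffordAlgebra Q10) * CliffordAlgebra.ι Q10 v *
                ((g⁻¹ : spinGroup Q10) : CliffordAlgebra Q10) →
            (w ∈ V (spinGLRep p (g, A) ρ) ↔ v ∈ V ρ)) := by
  have h : ∀ ρ : Spinor2 p, ∃ V, InOpenOrbit ρ →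
      IsSpinorSubspace ρ V ∧ ∀ W, IsSpinorSubspace ρ W → W = V := fun ρ => by
    by_cases hρ : InOpenOrbit ρ
    · obtain ⟨V, hV⟩ := hρ.exists_unique
      exact ⟨V, fun _ => hV⟩
    · exact ⟨⊥, fun h => absurd h hρ⟩
  choose V hV using h
  refine ⟨V, hV, fun ρ hρ g A v w hw => ?_⟩
  obtain ⟨L, hL⟩ := exists_rotation g
  have hwv : w = L v := ι_injective (hw.trans (hL v).symm)
  rw [hwv, ← (hV _ (hρ.spinGLRep (g, A))).2 _ ((hV ρ hρ).1.map hL A)]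
  constructor
  · rintro ⟨v', hv', h⟩
    rwa [← L.injective h]
  · exact fun hv => Submodule.mem_map_of_mem hv
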